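/- Let $d\ge 2$, $K>0$, $\gamma\ge 1$. A function $g:[0,1]^{d-1}\to[0,1]$ belongs to $\Sigma(K,\gamma)$ if it is continuously differentiable up to order $\lfloor\gamma\rfloor$ and, for all $\boldsymbol x,\boldsymbol y\in[0,1]^{d-1}$, its Taylor polynomial of degree $\lfloor\gamma\rfloor$ at $\boldsymbol x$ differs from $g$ at $\boldsymbol y$ by at most $K\|\boldsymbol y-\boldsymbol x\|^\gamma$. Write $\boldsymbol x=(\tilde{\boldsymbol x},x_d)\in[0,1]^{d-1}\times[0,1]$. A labeler $L$ assigns to each ground truth $g^*\in\Sigma(K,\gamma)$ a response distribution $P(Y=\cdot\mid\boldsymbol x)$ on $\{0,1,\perp\}$, $\boldsymbol x\in[0,1]^d$. Let $0\le C\le 1$, $\beta\ge 0$, and let $f:[0,1]\to[0,1]$ be nondecreasing. $L$ satisfies the two conditions if, for every $g^*\in\Sigma(K,\gamma)$: 1. $P(\perp\mid(\tilde{\boldsymbol x},x_d))\le P(\perp\mid(\tilde{\boldsymbol x},x_d'))$ whenever $|x_d-g^*(\tilde{\boldsymbol x})|\ge|x_d'-g^*(\tilde{\boldsymbol x})|$,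 and $P(Y\ne\mathbf 1[x_d>g^*(\tilde{\boldsymbol x})]\mid\boldsymbol x,Y\ne\perp)\le\frac12$ for all $\boldsymbol x$; 2. $P(\perp\mid\boldsymbol x)\le 1-f(|x_d-g^*(\tilde{\boldsymbol x})|)$ and $P(Y\ne\mathbf 1[x_d>g^*(\tilde{\boldsymbol x})]\mid\boldsymbol x,Y\ne\perp)\le\frac12\left(1-C|x_d-g^*(\tilde{\boldsymbol x})|^\beta\right)$ for all $\boldsymbol x$ (the bounds on conditional probabilities being required where $P(\perp\mid\boldsymbol x)\neq 1$). An active learning algorithm $\mathcal A$ (possibly randomized) chooses each query, decides whether to stop, and on stopping outputs a measurable $g:[0,1]^{d-1}\to\mathbb R$, all based on the past queries and responses only. Let $\Lambda(\epsilon,\delta,\mathcal A,L,g^*)\in\mathbb N\cup\{\infty\}$ be the least $N$ such that, when the responses come from $L$ with ground truth $g^*$, with probability at least $1-\delta$ the algorithm stops after at most $N$ queries and its output satisfies $\int_{[0,1]^{d-1}}|g-g^*|\le\epsilon$. **Theorem.** There are universal constants $\delta_0\in(0,1)$ and $c_0>0$ such that for all $d\ge2$, $K>0$, $\gamma\ge1$,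 $C\in[0,1]$, $\beta\ge0$ there are $\kappa>0$ and $\epsilon_0\in(0,1/c_0]$ such that for every nondecreasing $f:[0,1]\to[0,1]$ there is a labeler $L$ satisfying conditions 1 and 2 such that, for every active learning algorithm $\mathcal A$ and every $0<\epsilon\le\epsilon_0$, there is $g^*\in\Sigma(K,\gamma)$ with $$\Lambda(\epsilon,\delta_0,\mathcal A,L,g^*)\ \ge\ \frac{\kappa}{f(c_0\epsilon)}\,\epsilon^{-2\beta-\frac{d-1}{\gamma}}$$ (where the right-hand side is $\infty$ if $f(c_0\epsilon)=0$). -/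

import Mathlib

open MeasureTheory Set
open scoped ENNReal

/-- The closed unit cube `[0,1]^k`, as a subset of Euclidean space. -/
def unitCube (k : ℕ) : Set (EuclideanSpace ℝ (Fin k)) := {x | ∀ i, x i ∈ Icc (0 : ℝ) 1}

/-- The points of `[0,1]^k`, with the Euclidean metric. -/
abbrev Cube (k : ℕ) : Type := ↥(unitCube k)

/-- Lebesgue measure on `[0,1]^k`. -/
noncomputable def cubeVolume (k : ℕ) : Measure (Cube k) :=
  Measure.comap Subtype.val (volume : Measure (EuclideanSpace ℝ (Fin k)))

/-- The instance space `[0,1]^(k+1)`: a point is a pair `(x̃, x_d)` of its first `k` coordinates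
and its last coordinate. -/
abbrev Instance (k : ℕ) : Type := Cube k × ↥(Icc (0 : ℝ) 1)

/-- The answers of a labeler: `some true` is the label 1, `some false` is the label 0 and
`none` is the abstention `⊥`. -/
abbrev Response : Type := Option Bool

/-- `(K, γ)`-Hölder smoothness of a function on the closed unit cube: it is continuously
differentiable up to order `⌊γ⌋`, and its Taylor polynomial of degree `⌊γ⌋` at any `x` differs
from it at any `y` by at most `K ‖y - x‖ ^ γ`. The derivatives are those within the cube, so that
the values `0` of the extension outside of the cube play no role. -/
def IsHolderSmooth {k : ℕ} (K γ : ℝ) (g : Cube k → ℝ) : Prop :=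
  let G : EuclideanSpace ℝ (Fin k) → ℝ := Function.extend Subtype.val g 0
  ContDiffOn ℝ (⌊γ⌋₊ : ℕ) G (unitCube k) ∧
    ∀ x ∈ unitCube k, ∀ y ∈ unitCube k,
      |G y - ∑ m ∈ Finset.range (⌊γ⌋₊ + 1),
        iteratedFDerivWithin ℝ m G (unitCube k) x (fun _ => y - x) / (m.factorial : ℝ)|
        ≤ K * ‖y - x‖ ^ γ

/-- The `(K, γ)`-Hölder smooth decision boundaries `[0,1]^k → [0,1]`. -/
def smoothBoundaries (k : ℕ) (K γ : ℝ) : Set (Cube k → ℝ) :=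
  {g | IsHolderSmooth K γ g ∧ ∀ x, g x ∈ Icc (0 : ℝ) 1}

/-- The label `𝟙[x_d > g(x̃)]` that the boundary `g` assigns to the instance `x`. -/
noncomputable def trueLabel {k : ℕ} (g : Cube k → ℝ) (x : Instance k) : Bool :=
  open Classical in decide (g x.1 < (x.2 : ℝ))

/-- The vertical distance `|x_d - g(x̃)|` of the instance `x` to the boundary `g`. -/
def boundaryDist {k : ℕ} (g : Cube k → ℝ) (x : Instance k) : ℝ := |(x.2 : ℝ) - g x.1|

/-- The `L¹` distance of two boundaries (infinite if the difference is not integrable). -/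
noncomputable def boundaryError {k : ℕ} (g g' : Cube k → ℝ) : ℝ≥0∞ :=
  ∫⁻ x, ‖g x - g' x‖ₑ ∂(cubeVolume k)

/-- A response distribution `P(Y ∣ X)`: a probability distribution on the answers for every
instance, depending measurably on the instance. -/
structure ResponseLaw (k : ℕ) where
  prob : Instance k → PMF Response
  measurable_prob : ∀ y, Measurable fun x => prob x y

/-- A labeler: for every ground truth boundary, a response distribution. -/
abbrev Labeler (k : ℕ) : Type := (Cube k → ℝ) → ResponseLaw k

/-- `P(⊥ ∣ x)`. -/
noncomputable def ResponseLaw.abstainRate {k : ℕ} (P : ResponseLaw k) (x : Instance k) : ℝ :=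
  (P.prob x none).toReal

/-- `P(Y ≠ 𝟙[x_d > g(x̃)] ∣ x, Y ≠ ⊥)`, meaningful if `P(⊥ ∣ x) ≠ 1`. -/
noncomputable def ResponseLaw.noiseRate {k : ℕ} (P : ResponseLaw k) (g : Cube k → ℝ)
    (x : Instance k) : ℝ :=
  (P.prob x (some (!(trueLabel g x)))).toReal /
    ((P.prob x (some true)).toReal + (P.prob x (some false)).toReal)

/-- The first condition on the labeler: at fixed `x̃`, the abstention rate does not increase with
the distance to the boundary, and a label that is given is wrong with probability at most `1/2`. -/
structure MonotoneAbstention {k : ℕ} (g : Cube k → ℝ) (P : ResponseLaw k) : Prop where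
  abstention : ∀ (x : Cube k) (t t' : ↥(Icc (0 : ℝ) 1)),
    boundaryDist g (x, t') ≤ boundaryDist g (x, t) → P.abstainRate (x, t) ≤ P.abstainRate (x, t')
  noise : ∀ x, P.abstainRate x ≠ 1 → P.noiseRate g x ≤ 1 / 2

/-- The second condition on the labeler, with parameters `f`, `C` and `β`. -/
structure BoundedNoise {k : ℕ} (f : ℝ → ℝ) (C β : ℝ) (g : Cube k → ℝ) (P : ResponseLaw k) :
    Prop where
  abstention : ∀ x, P.abstainRate x ≤ 1 - f (boundaryDist g x)
  noise : ∀ x, P.abstainRate x ≠ 1 → P.noiseRate g x ≤ 1 / 2 * (1 - C * boundaryDist g x ^ β)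

/-- A randomized active learning algorithm. It draws a random seed `ω` once; then, as a function
of the seed and of the list of the answers received so far, it decides whether to stop, which
instance to query next if it does not stop, and which boundary to output if it does. (The
instances queried so far are determined by the seed and the answers.) The output need not be a
smooth boundary. -/
structure ActiveLearner (k : ℕ) where
  Ω : Type
  [mΩ : MeasurableSpace Ω]
  μ : Measure Ω
  [isProb : IsProbabilityMeasure μ]
  halts : Ω → List Response → Prop
  query : Ω → List Response → Instance k
  output : Ω → List Response → Cube k → ℝ
  measurableSet_halts : ∀ h, MeasurableSet {ω | halts ω h}
  measurable_query : ∀ h, Measurable fun ω => query ω h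
  measurable_output : ∀ h, Measurable fun p : Ω × Cube k => output p.1 h p.2

namespace ActiveLearner

attribute [instance] ActiveLearner.mΩ ActiveLearner.isProb

variable {k : ℕ}

/-- With the seed `ω` and the answers `h`, the algorithm stops after exactly `h.length` queries. -/
def StopsAt (A : ActiveLearner k) (ω : A.Ω) (h : List Response) : Prop :=
  A.halts ω h ∧ ∀ t < h.length, ¬ A.halts ω (h.take t)

/-- Given the seed `ω`, the probability that the answers to the first `h.length` queries are `h`,
where each answer is drawn from `P` at the instance that is queried. -/
noncomputable def transcriptProb (A : ActiveLearner k) (P : ResponseLaw k) (ω : A.Ω)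
    (h : List Response) : ℝ≥0∞ :=
  ∏ i : Fin h.length, P.prob (A.query ω (h.take i)) (h.get i)

/-- The probability, over the seed and the answers drawn from `P`, that the algorithm stops after
at most `N` queries and outputs a boundary within `L¹` distance `ε` of `g`. -/
noncomputable def successProb (A : ActiveLearner k) (P : ResponseLaw k) (g : Cube k → ℝ)
    (ε : ℝ) (N : ℕ) : ℝ≥0∞ :=
  open Classical in
  ∫⁻ ω, ∑ n ∈ Finset.range (N + 1), ∑ y : Fin n → Response,
    (if A.StopsAt ω (List.ofFn y) ∧
        boundaryError (A.output ω (List.ofFn y)) g ≤ ENNReal.ofReal ε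
      then A.transcriptProb P ω (List.ofFn y) else 0) ∂A.μ

/-- The query complexity `Λ(ε, δ, A, L, g)`: the least `N` such that, with probability at least
`1 - δ`, the algorithm stops after at most `N` queries to the labeler and outputs a boundary within
`L¹` distance `ε` of the ground truth `g`; it is `∞` if there is no such `N`. -/
noncomputable def queryComplexity (ε δ : ℝ) (A : ActiveLearner k) (L : Labeler k)
    (g : Cube k → ℝ) : ℕ∞ :=
  ⨅ (N : ℕ) (_ : ENNReal.ofReal (1 - δ) ≤ A.successProb (L g) g ε N), (N : ℕ∞)

end ActiveLearner

/-! The proof is an Assouad argument over smooth boundaries carrying many small bumps. Put `k = d -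
1` and `h = 64 ε`, and divide the cube into `M = m ^ k` cells. For each bit vector `σ` on the cells
let `g_σ` equal `h` plus a bump of height `h` in every cell selected by `σ`. Smoothness allows `m`
of order `h ^ (-1 / γ)`, so `M` is of order `ε ^ (-k / γ)`, and a boundary within `ε` of `g_σ`
determines all but at most `M / 16` of the bits.

The labeler has to be fixed before `ε`, so it reads the scale off the ground truth: `zoneHeight` is
four times the value at the corner `0` whenever the boundary never exceeds twice that value (and the
result is at most `1`). All `g_σ` take the value `h` at the corner, hence share the zone height `4 h
= 256 ε`. Inside the zone the labeler answers with probability `f (4 h)` and its label has bias `C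
(4 h) ^ β`, whatever the position. Above the zone its answers are the same for all `σ`. Since the
distance to the boundary is at most `4 h` inside the zone, both conditions hold.

An answer therefore concerns only the bit of the queried column
(`IsBump.exists_forall_bumpField_eq`) and carries information at most `θ = f (4 h) (C (4 h) ^ β) ^
2` about it (`sum_answerProb_mul_log_le`). The chain rule along the tree of answers
(`exp_neg_le_treeExp_exp_neg`) bounds the information of an adaptive strategy, and
`le_sum_sum_treeExp` shows that while `N θ ≤ M / 64` at least `5 / 16` of the bits are wrong on
average. The mean success probability is then at most `11 / 15 < 3 / 4`, so some `g_σ` needs more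
than `M / (64 θ)` queries. -/

/-! ### Taylor remainders and Hölder smoothness on the cube -/

-- For `‖w‖ ≤ 1` the integral remainder has order `n + 1 ≥ γ`. For `‖w‖ ≥ 1` no cancellation is
-- needed: the value and each of the `n + 1` Taylor terms are at most `B * ‖w‖ ^ γ`, which gives the
-- factor `n + 2`.
open scoped ContDiff in
theorem abs_sub_taylor_le {E : Type*} [NormedAddCommGroup E] [NormedSpace ℝ E]
    {Φ : E → ℝ} (hΦ : ContDiff ℝ ∞ Φ) {n : ℕ} {B γ : ℝ}
    (hB : ∀ i ≤ n + 1, ∀ x, ‖iteratedFDeriv ℝ i Φ x‖ ≤ B) (hn : n ≤ γ) (hγ : γ ≤ n + 1)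
    (u w : E) :
    |Φ (u + w) - ∑ i ∈ Finset.range (n + 1),
      iteratedFDeriv ℝ i Φ u (fun _ => w) / (i.factorial : ℝ)| ≤ (n + 2) * B * ‖w‖ ^ γ := by
  have hB0 : 0 ≤ B := (norm_nonneg _).trans (hB 0 (by omega) u)
  have hterm : ∀ i ≤ n + 1, ∀ x, |iteratedFDeriv ℝ i Φ x (fun _ => w)| ≤ B * ‖w‖ ^ i := by
    intro i hi x
    have := (iteratedFDeriv ℝ i Φ x).le_opNorm (fun _ => w)
    simp only [Finset.prod_const, Finset.card_univ, Fintype.card_fin, Real.norm_eq_abs] at this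
    exact this.trans (mul_le_mul_of_nonneg_right (hB i hi x) (by positivity))
  have hγ0 : 0 ≤ γ := (Nat.cast_nonneg n).trans hn
  rcases le_total ‖w‖ 1 with hw | hw
  · rcases (norm_nonneg w).eq_or_lt with hw0 | hw0
    · have hw' : w = 0 := by simpa using hw0.symm
      subst hw'
      have : ∑ i ∈ Finset.range (n + 1),
          iteratedFDeriv ℝ i Φ u (fun _ => (0 : E)) / (i.factorial : ℝ) = Φ u := by
        rw [Finset.sum_eq_single 0]
        · simp
        · intro i _ hi
          have : Nonempty (Fin i) := ⟨⟨0, by omega⟩⟩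
          have : iteratedFDeriv ℝ i Φ u (fun _ => (0 : E)) = 0 :=
            (iteratedFDeriv ℝ i Φ u).map_zero
          simp [this]
        · simp
      rw [this]
      simp only [add_zero, sub_self, abs_zero]
      positivity
    · have key := map_add_eq_sum_add_integral_iteratedFDeriv (f := Φ) (x := u) (y := w) (n := n)
        (fun t _ => (hΦ.of_le (by exact_mod_cast le_top)).contDiffAt)
      have hsum : ∑ k ∈ Finset.range (n + 1),
          ((k.factorial : ℝ)⁻¹ • (iteratedFDeriv ℝ k Φ u (fun _ ↦ w)))
          = ∑ i ∈ Finset.range (n + 1),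
              iteratedFDeriv ℝ i Φ u (fun _ => w) / (i.factorial : ℝ) :=
        Finset.sum_congr rfl fun i _ => by rw [smul_eq_mul, inv_mul_eq_div]
      rw [key, hsum, add_sub_cancel_left, smul_eq_mul, abs_mul]
      have hint : ‖∫ t in (0 : ℝ)..1, (1 - t) ^ n • iteratedFDeriv ℝ (n + 1) Φ (u + t • w)
          (fun _ ↦ w)‖ ≤ B * ‖w‖ ^ (n + 1) * |1 - 0| := by
        apply intervalIntegral.norm_integral_le_of_norm_le_const
        intro t ht
        rw [uIoc_of_le zero_le_one] at ht
        rw [norm_smul, Real.norm_eq_abs, Real.norm_eq_abs, abs_pow,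
          abs_of_nonneg (by linarith [ht.2] : 0 ≤ 1 - t)]
        calc _ ≤ 1 * |iteratedFDeriv ℝ (n + 1) Φ (u + t • w) (fun _ ↦ w)| :=
              mul_le_mul_of_nonneg_right
                (pow_le_one₀ (by linarith [ht.2]) (by linarith [ht.1])) (abs_nonneg _)
          _ ≤ _ := by rw [one_mul]; exact hterm _ le_rfl _
      rw [Real.norm_eq_abs, sub_zero, abs_one, mul_one] at hint
      have hfac : |((n.factorial : ℝ))⁻¹| ≤ 1 := by
        rw [abs_of_nonneg (by positivity)]
        exact inv_le_one_of_one_le₀ (by exact_mod_cast n.factorial_pos)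
      have hpow : ‖w‖ ^ (n + 1) ≤ ‖w‖ ^ γ := by
        rw [← Real.rpow_natCast]
        exact Real.rpow_le_rpow_of_exponent_ge hw0 hw (by push_cast; exact hγ)
      calc _ ≤ 1 * (B * ‖w‖ ^ (n + 1)) :=
            mul_le_mul hfac hint (abs_nonneg _) zero_le_one
        _ ≤ 1 * (B * ‖w‖ ^ γ) := by gcongr
        _ ≤ _ := by
          rw [mul_assoc]
          apply mul_le_mul_of_nonneg_right _ (by positivity)
          have : (0 : ℝ) ≤ n := Nat.cast_nonneg n
          linarith
  · have hpow : ∀ i ≤ n, ‖w‖ ^ i ≤ ‖w‖ ^ γ := by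
      intro i hi
      rw [← Real.rpow_natCast]
      exact Real.rpow_le_rpow_of_exponent_le hw ((Nat.cast_le.mpr hi).trans hn)
    have h1 : |Φ (u + w)| ≤ B * ‖w‖ ^ γ := by
      have := hB 0 (by omega) (u + w)
      rw [norm_iteratedFDeriv_zero, Real.norm_eq_abs] at this
      exact this.trans (le_mul_of_one_le_right hB0 (Real.one_le_rpow hw hγ0))
    have h2 : |∑ i ∈ Finset.range (n + 1),
        iteratedFDeriv ℝ i Φ u (fun _ => w) / (i.factorial : ℝ)| ≤ (n + 1) * (B * ‖w‖ ^ γ) := by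
      refine (Finset.abs_sum_le_sum_abs _ _).trans ?_
      refine (Finset.sum_le_card_nsmul _ _ (B * ‖w‖ ^ γ) ?_).trans ?_
      · intro i hi
        have hi' : i ≤ n := by simpa [Nat.lt_succ_iff] using hi
        rw [abs_div, abs_of_nonneg (a := (i.factorial : ℝ)) (Nat.cast_nonneg _)]
        refine (div_le_self (abs_nonneg _) (by exact_mod_cast i.factorial_pos)).trans ?_
        exact (hterm i (by omega) u).trans (mul_le_mul_of_nonneg_left (hpow i hi') hB0)
      · simp
    calc _ ≤ _ := abs_sub _ _
      _ ≤ B * ‖w‖ ^ γ + (n + 1) * (B * ‖w‖ ^ γ) := add_le_add h1 h2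
      _ = _ := by ring

theorem convex_unitCube (k : ℕ) : Convex ℝ (unitCube k) := by
  intro x hx y hy a b ha hb hab i
  exact (convex_Icc (0 : ℝ) 1) (hx i) (hy i) ha hb hab

theorem isOpen_setOf_forall_mem_Ioo (k : ℕ) (a b : ℝ) :
    IsOpen {x : EuclideanSpace ℝ (Fin k) | ∀ i, x i ∈ Ioo a b} := by
  simp only [ofPred_forall]
  exact isOpen_iInter_of_finite fun i => isOpen_Ioo.preimage (by fun_prop)

theorem isClosed_setOf_forall_mem_Icc (k : ℕ) (a b : ℝ) :
    IsClosed {x : EuclideanSpace ℝ (Fin k) | ∀ i, x i ∈ Icc a b} := by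
  simp only [ofPred_forall]
  exact isClosed_iInter fun i => isClosed_Icc.preimage (by fun_prop)

theorem isCompact_setOf_forall_mem_Icc (k : ℕ) (a b : ℝ) :
    IsCompact {x : EuclideanSpace ℝ (Fin k) | ∀ i, x i ∈ Icc a b} := by
  have h : IsCompact (Set.pi univ fun _ : Fin k => Icc a b) :=
    isCompact_univ_pi fun _ => isCompact_Icc
  have := (EuclideanSpace.equiv (Fin k) ℝ).toHomeomorph.isClosedEmbedding.isCompact_preimage h
  convert this using 1
  ext x
  simp [EuclideanSpace.equiv, -pi_univ_Icc]

theorem uniqueDiffOn_unitCube (k : ℕ) : UniqueDiffOn ℝ (unitCube k) := by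
  refine uniqueDiffOn_convex (convex_unitCube k) ⟨WithLp.toLp 2 fun _ => 1 / 2, ?_⟩
  refine interior_maximal (s := unitCube k) (fun x (hx : ∀ i, x i ∈ Ioo (0 : ℝ) 1) i =>
    Ioo_subset_Icc_self (hx i)) (isOpen_setOf_forall_mem_Ioo k 0 1) ?_
  intro i
  norm_num

-- The cube has unique derivatives, so those of the zero extension within the cube are those of the
-- globally smooth function. Rescaling the argument by `r` costs the factor `r ^ γ`, which limits
-- how fine the grid can be.
open scoped ContDiff in
theorem isHolderSmooth_of_iteratedFDeriv_le {k : ℕ} {Φ : EuclideanSpace ℝ (Fin k) → ℝ}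
    (hΦ : ContDiff ℝ ∞ Φ) {B γ K h r : ℝ} (hγ : 0 ≤ γ) (hh : 0 ≤ h) (hr : 0 < r)
    (hB : ∀ i ≤ ⌊γ⌋₊ + 1, ∀ x, ‖iteratedFDeriv ℝ i Φ x‖ ≤ B)
    (hK : h * r ^ γ * ((⌊γ⌋₊ + 2) * B) ≤ K) {g : Cube k → ℝ}
    (hg : ∀ x : Cube k, g x = h * Φ (r • x.1)) : IsHolderSmooth K γ g := by
  set G : EuclideanSpace ℝ (Fin k) → ℝ := Function.extend Subtype.val g 0 with hG
  set G' : EuclideanSpace ℝ (Fin k) → ℝ := fun x => h • Φ (r • x) with hG'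
  have hGG : EqOn G G' (unitCube k) := by
    intro x hx
    have : G x = g ⟨x, hx⟩ := Subtype.val_injective.extend_apply g 0 ⟨x, hx⟩
    rw [this, hg]
    rfl
  have hsm : ContDiff ℝ ∞ fun x => Φ (r • x) := hΦ.comp (contDiff_const_smul r)
  have hcd : ContDiff ℝ ∞ G' := contDiff_const_smul h |>.comp hsm
  have hle : ∀ i : ℕ, (i : WithTop ℕ∞) ≤ ((⊤ : ℕ∞) : WithTop ℕ∞) := fun i => by exact_mod_cast le_top
  have hder : ∀ i : ℕ, ∀ x ∈ unitCube k, iteratedFDerivWithin ℝ i G (unitCube k) x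
      = h • r ^ i • iteratedFDeriv ℝ i Φ (r • x) := by
    intro i x hx
    rw [iteratedFDerivWithin_congr hGG hx, iteratedFDerivWithin_eq_iteratedFDeriv
      (uniqueDiffOn_unitCube k) (hcd.of_le (hle i)).contDiffAt hx, hG',
      iteratedFDeriv_const_smul_apply' (hsm.of_le (hle i)).contDiffAt,
      iteratedFDeriv_comp_const_smul r (hΦ.of_le (hle i))]
  refine ⟨((hcd.of_le (hle _)).contDiffOn).congr hGG, ?_⟩
  intro x hx y hy
  have key := abs_sub_taylor_le hΦ hB (Nat.floor_le hγ) (Nat.lt_floor_add_one γ).le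
    (r • x) (r • (y - x))
  have e1 : G y - ∑ m ∈ Finset.range (⌊γ⌋₊ + 1),
      iteratedFDerivWithin ℝ m G (unitCube k) x (fun _ => y - x) / (m.factorial : ℝ)
      = h * (Φ (r • x + r • (y - x)) - ∑ i ∈ Finset.range (⌊γ⌋₊ + 1),
        iteratedFDeriv ℝ i Φ (r • x) (fun _ => r • (y - x)) / (i.factorial : ℝ)) := by
    have hxy : r • x + r • (y - x) = r • y := by rw [← smul_add]; simp
    rw [mul_sub, Finset.mul_sum, hxy, hGG hy]
    congr 1
    refine Finset.sum_congr rfl fun i _ => ?_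
    rw [hder i x hx, ContinuousMultilinearMap.map_smul_univ]
    simp
    ring
  rw [e1, abs_mul, abs_of_nonneg hh]
  calc _ ≤ h * ((⌊γ⌋₊ + 2) * B * ‖r • (y - x)‖ ^ γ) := mul_le_mul_of_nonneg_left key hh
    _ = h * r ^ γ * ((⌊γ⌋₊ + 2) * B) * ‖y - x‖ ^ γ := by
      rw [norm_smul, Real.norm_of_nonneg hr.le, Real.mul_rpow hr.le (norm_nonneg _)]
      ring
    _ ≤ _ := by gcongr

/-! ### Bump fields on a grid -/

/-- The translation vector of a cell of the grid `Fin k → Fin m`. -/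
noncomputable def cellShift {k m : ℕ} (j : Fin k → Fin m) : EuclideanSpace ℝ (Fin k) :=
  WithLp.toLp 2 fun i => ((j i : ℕ) : ℝ)

theorem cellShift_eq_of_mem {k m : ℕ} {j j' : Fin k → Fin m} {u : EuclideanSpace ℝ (Fin k)}
    (h : ∀ i, (u - cellShift j) i ∈ Ico (0 : ℝ) 1) (h' : ∀ i, (u - cellShift j') i ∈ Ico (0 : ℝ) 1) :
    j = j' := by
  funext i
  have h1 := h i
  have h2 := h' i
  simp only [cellShift, PiLp.sub_apply, mem_Ico] at h1 h2
  have a : ((j i : ℕ) : ℝ) < (j' i : ℕ) + 1 := by linarith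
  have b : ((j' i : ℕ) : ℝ) < (j i : ℕ) + 1 := by linarith
  norm_cast at a b
  exact Fin.ext (by omega)

/-- The bumps `φ` in the cells selected by `σ`, on top of the constant `1`. -/
noncomputable def bumpField {k m : ℕ} (φ : EuclideanSpace ℝ (Fin k) → ℝ)
    (σ : (Fin k → Fin m) → Bool) (u : EuclideanSpace ℝ (Fin k)) : ℝ :=
  1 + ∑ j, (if σ j then (1 : ℝ) else 0) • φ (u - cellShift j)

open scoped ContDiff in
/-- A smooth bump that is `1` on `[η, 1 - η]^k` and supported in the interior of the cube. -/
structure IsBump {k : ℕ} (η : ℝ) (φ : EuclideanSpace ℝ (Fin k) → ℝ) : Prop where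
  contDiff : ContDiff ℝ ∞ φ
  mem_Icc : ∀ x, φ x ∈ Icc (0 : ℝ) 1
  eq_one : ∀ x, (∀ i, x i ∈ Icc η (1 - η)) → φ x = 1
  tsupport_subset : ∀ x ∈ tsupport φ, ∀ i, x i ∈ Ioo (0 : ℝ) 1

open scoped ContDiff Manifold in
theorem exists_isBump (k : ℕ) {η : ℝ} (hη : 0 < η) :
    ∃ φ : EuclideanSpace ℝ (Fin k) → ℝ, IsBump η φ := by
  obtain ⟨φ, h1, h2, h3, h4⟩ := exists_contMDiff_support_eq_eq_one_iff (n := ((⊤ : ℕ∞)))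
    (modelWithCornersSelf ℝ (EuclideanSpace ℝ (Fin k)))
    (isOpen_setOf_forall_mem_Ioo k (η / 2) (1 - η / 2))
    (isClosed_setOf_forall_mem_Icc k η (1 - η))
    (fun x hx i => ⟨by linarith [(hx i).1], by linarith [(hx i).2]⟩)
  refine ⟨φ, h1.contDiff, fun x => h2 (mem_range_self x), fun x hx => (h4 x).1 hx, ?_⟩
  have : tsupport φ ⊆ {x | ∀ i, x i ∈ Icc (η / 2) (1 - η / 2)} := by
    refine closure_minimal ?_ (isClosed_setOf_forall_mem_Icc k _ _)
    rw [h3]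
    exact fun x hx i => Ioo_subset_Icc_self (hx i)
  exact fun x hx i => ⟨by linarith [(this hx i).1], by linarith [(this hx i).2]⟩

namespace IsBump

variable {k m : ℕ} {η : ℝ} {φ : EuclideanSpace ℝ (Fin k) → ℝ}

theorem hasCompactSupport (hφ : IsBump η φ) : HasCompactSupport φ :=
  (isCompact_setOf_forall_mem_Icc k 0 1).of_isClosed_subset (isClosed_tsupport φ)
    fun x hx i => Ioo_subset_Icc_self (hφ.tsupport_subset x hx i)

theorem exists_iteratedFDeriv_le (hφ : IsBump η φ) (N : ℕ) :
    ∃ B, ∀ i ≤ N, ∀ x, ‖iteratedFDeriv ℝ i φ x‖ ≤ B := by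
  have h : ∀ i : ℕ, ∃ B, ∀ x, ‖iteratedFDeriv ℝ i φ x‖ ≤ B := fun i =>
    (hφ.hasCompactSupport.iteratedFDeriv i).exists_bound_of_continuous
      (hφ.contDiff.continuous_iteratedFDeriv (by exact_mod_cast le_top))
  choose B hB using h
  refine ⟨∑ i ∈ Finset.range (N + 1), B i, fun i hi x => (hB i x).trans ?_⟩
  exact Finset.single_le_sum (f := B) (fun j _ => (norm_nonneg _).trans (hB j x))
    (Finset.mem_range.2 (by omega))

/-- Shifted bumps live in disjoint open cells. The summand `t` is arbitrary so that the argument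
serves both for values and for derivatives. -/
theorem sum_shift_eq (hφ : IsBump η φ) (u : EuclideanSpace ℝ (Fin k)) {j : Fin k → Fin m}
    (hj : ∀ i, (u - cellShift j) i ∈ Ico (0 : ℝ) 1) {F : Type*} [AddCommMonoid F]
    (t : (Fin k → Fin m) → F)
    (ht : ∀ j, u - cellShift j ∉ tsupport φ → t j = 0) : ∑ j, t j = t j := by
  refine Fintype.sum_eq_single j fun j' hj' => ht j' fun hmem => hj' ?_
  exact cellShift_eq_of_mem (fun i => Ioo_subset_Ico_self (hφ.tsupport_subset _ hmem i)) hj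

theorem norm_sum_shift_le (hφ : IsBump η φ) (u : EuclideanSpace ℝ (Fin k)) {F : Type*}
    [NormedAddCommGroup F] (t : (Fin k → Fin m) → F) {B : ℝ} (hB : 0 ≤ B) (htB : ∀ j, ‖t j‖ ≤ B)
    (ht : ∀ j, u - cellShift j ∉ tsupport φ → t j = 0) : ‖∑ j, t j‖ ≤ B := by
  by_cases h : ∃ j : Fin k → Fin m, u - cellShift j ∈ tsupport φ
  · obtain ⟨j, hj⟩ := h
    rw [hφ.sum_shift_eq u (fun i => Ioo_subset_Ico_self (hφ.tsupport_subset _ hj i)) t ht]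
    exact htB j
  · push Not at h
    rw [Finset.sum_eq_zero fun j _ => ht j (h j), norm_zero]
    exact hB

open scoped ContDiff in
theorem contDiff_bumpField (hφ : IsBump η φ) (σ : (Fin k → Fin m) → Bool) :
    ContDiff ℝ ∞ (bumpField φ σ) := by
  have := hφ.contDiff
  unfold bumpField
  fun_prop

/-- At most one bump contributes at each point, so the bound depends neither on the number of cells
nor on `σ`. -/
theorem iteratedFDeriv_bumpField_le (hφ : IsBump η φ) {N : ℕ} {B : ℝ}
    (hB : ∀ i ≤ N, ∀ x, ‖iteratedFDeriv ℝ i φ x‖ ≤ B) (σ : (Fin k → Fin m) → Bool)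
    (i : ℕ) (hi : i ≤ N) (u : EuclideanSpace ℝ (Fin k)) :
    ‖iteratedFDeriv ℝ i (bumpField φ σ) u‖ ≤ 1 + B := by
  have hB0 : 0 ≤ B := (norm_nonneg _).trans (hB i hi u)
  have hle : (i : WithTop ℕ∞) ≤ ((⊤ : ℕ∞) : WithTop ℕ∞) := by exact_mod_cast le_top
  have hs : ∀ j : Fin k → Fin m, ContDiff ℝ i (fun u => φ (u - cellShift j)) := fun j =>
    (hφ.contDiff.of_le hle).comp (contDiff_id.sub contDiff_const)
  have e : bumpField φ σ = (fun _ => (1 : ℝ)) + fun u => ∑ j,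
      (if σ j then (1 : ℝ) else 0) • φ (u - cellShift j) := rfl
  rw [e, iteratedFDeriv_add_apply contDiffAt_const
    (ContDiff.sum fun j _ => (hs j).const_smul _).contDiffAt]
  refine (norm_add_le _ _).trans (add_le_add ?_ ?_)
  · rcases Nat.eq_zero_or_pos i with rfl | hi0
    · rw [norm_iteratedFDeriv_zero]; simp
    · rw [iteratedFDeriv_const_of_ne (by omega)]; simp
  · rw [iteratedFDeriv_fun_sum_apply
      (fun j _ => ((hs j).const_smul _).contDiffAt)]
    refine hφ.norm_sum_shift_le u _ hB0 ?_ ?_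
    · intro j
      rw [iteratedFDeriv_const_smul_apply' (hs j).contDiffAt, iteratedFDeriv_comp_sub, norm_smul]
      have := hB i hi (u - cellShift j)
      split <;> simp [this, hB0]
    · intro j hj
      rw [iteratedFDeriv_const_smul_apply' (hs j).contDiffAt, iteratedFDeriv_comp_sub]
      have : iteratedFDeriv ℝ i φ (u - cellShift j) = 0 := by
        by_contra hne
        exact hj (support_iteratedFDeriv_subset i hne)
      rw [this, smul_zero]

theorem bumpField_eq (hφ : IsBump η φ) (σ : (Fin k → Fin m) → Bool)
    {u : EuclideanSpace ℝ (Fin k)} {j : Fin k → Fin m}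
    (hj : ∀ i, (u - cellShift j) i ∈ Ico (0 : ℝ) 1) :
    bumpField φ σ u = 1 + (if σ j then (1 : ℝ) else 0) • φ (u - cellShift j) := by
  rw [bumpField, hφ.sum_shift_eq u hj]
  intro j hj
  rw [image_eq_zero_of_notMem_tsupport hj, smul_zero]

theorem bumpField_eq_one (σ : (Fin k → Fin m) → Bool)
    {u : EuclideanSpace ℝ (Fin k)}
    (h : ∀ j : Fin k → Fin m, u - cellShift j ∉ tsupport φ) : bumpField φ σ u = 1 := by
  rw [bumpField, Finset.sum_eq_zero, add_zero]
  intro j _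
  rw [image_eq_zero_of_notMem_tsupport (h j), smul_zero]

theorem bumpField_mem_Icc (hφ : IsBump η φ) (σ : (Fin k → Fin m) → Bool)
    (u : EuclideanSpace ℝ (Fin k)) : bumpField φ σ u ∈ Icc (1 : ℝ) 2 := by
  by_cases h : ∃ j : Fin k → Fin m, u - cellShift j ∈ tsupport φ
  · obtain ⟨j, hj⟩ := h
    rw [hφ.bumpField_eq σ (fun i => Ioo_subset_Ico_self (hφ.tsupport_subset _ hj i))]
    have := hφ.mem_Icc (u - cellShift j)
    rw [Set.mem_Icc] at this ⊢
    split <;> constructor <;> simp <;> linarith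
  · push Not at h
    rw [bumpField_eq_one σ h]
    norm_num

/-- The value of a bump field at a point depends on a single bit. -/
theorem exists_forall_bumpField_eq (hφ : IsBump η φ) (j₀ : Fin k → Fin m)
    (u : EuclideanSpace ℝ (Fin k)) : ∃ j, ∀ σ σ' : (Fin k → Fin m) → Bool, σ j = σ' j →
      bumpField φ σ u = bumpField φ σ' u := by
  by_cases h : ∃ j : Fin k → Fin m, u - cellShift j ∈ tsupport φ
  · obtain ⟨j, hj⟩ := h
    refine ⟨j, fun σ σ' hσ => ?_⟩
    have hj' := fun i => Ioo_subset_Ico_self (hφ.tsupport_subset _ hj i)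
    rw [hφ.bumpField_eq σ hj', hφ.bumpField_eq σ' hj', hσ]
  · push Not at h
    exact ⟨j₀, fun σ σ' _ => by rw [bumpField_eq_one σ h, bumpField_eq_one σ' h]⟩

/-- The corner lies in no open cell. This is what makes the zone height independent of `σ`. -/
theorem bumpField_zero (hφ : IsBump η φ) (hk : 0 < k) (σ : (Fin k → Fin m) → Bool) :
    bumpField φ σ 0 = 1 := by
  refine bumpField_eq_one σ fun j hj => ?_
  have := (hφ.tsupport_subset _ hj ⟨0, hk⟩).1
  have h0 : (0 - cellShift j) ⟨0, hk⟩ = -((j ⟨0, hk⟩ : ℕ) : ℝ) := by simp [cellShift]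
  rw [h0] at this
  linarith [(Nat.cast_nonneg (j ⟨0, hk⟩ : ℕ) : (0 : ℝ) ≤ _)]

end IsBump

/-! ### Expectations and information along a tree of adaptive observations -/

section Tree

variable {R : Type*} [Fintype R]

/-- The expectation of `F` at the history reached from `h` by appending `n` random symbols, where
`p h` is the law of the symbol that follows the history `h`. -/
noncomputable def treeExp (p : List R → R → ℝ) : ℕ → (List R → ℝ) → List R → ℝ
  | 0, F, h => F h
  | n + 1, F, h => ∑ r, p h r * treeExp p n F (h ++ [r])

/-- The expected sum of the costs `c` of the first `n` histories that are reached from `h`. -/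
noncomputable def treeCost (p : List R → R → ℝ) (c : List R → ℝ) : ℕ → List R → ℝ
  | 0, _ => 0
  | n + 1, h => c h + ∑ r, p h r * treeCost p c n (h ++ [r])

variable {p q : List R → R → ℝ}

theorem treeExp_mono (hp : ∀ h r, 0 ≤ p h r) {F G : List R → ℝ} (n : ℕ) (h : List R)
    (hFG : ∀ l, l.length = n → F (h ++ l) ≤ G (h ++ l)) :
    treeExp p n F h ≤ treeExp p n G h := by
  induction n generalizing h with
  | zero => simpa [treeExp] using hFG [] rfl
  | succ n ih =>
    refine Finset.sum_le_sum fun r _ => mul_le_mul_of_nonneg_left (ih _ fun l hl => ?_) (hp h r)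
    simpa using hFG (r :: l) (by simp [hl])

theorem treeExp_congr {F G : List R → ℝ} (n : ℕ) (h : List R)
    (hFG : ∀ l, l.length = n → F (h ++ l) = G (h ++ l)) :
    treeExp p n F h = treeExp p n G h := by
  induction n generalizing h with
  | zero => simpa [treeExp] using hFG [] rfl
  | succ n ih =>
    refine Finset.sum_congr rfl fun r _ => ?_
    rw [ih _ fun l hl => by simpa using hFG (r :: l) (by simp [hl])]

theorem treeExp_const (hp : ∀ h, ∑ r, p h r = 1) (a : ℝ) (n : ℕ) (h : List R) :
    treeExp p n (fun _ => a) h = a := by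
  induction n generalizing h with
  | zero => rfl
  | succ n ih => simp only [treeExp, ih, ← Finset.sum_mul, hp, one_mul]

theorem treeExp_add (F G : List R → ℝ) (n : ℕ) (h : List R) :
    treeExp p n (fun z => F z + G z) h = treeExp p n F h + treeExp p n G h := by
  induction n generalizing h with
  | zero => rfl
  | succ n ih => simp only [treeExp, ih, mul_add, Finset.sum_add_distrib]

theorem treeExp_const_mul (a : ℝ) (F : List R → ℝ) (n : ℕ) (h : List R) :
    treeExp p n (fun z => a * F z) h = a * treeExp p n F h := by
  induction n generalizing h with
  | zero => rfl
  | succ n ih =>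
    simp only [treeExp, ih, Finset.mul_sum]
    exact Finset.sum_congr rfl fun r _ => by ring

theorem treeExp_sum {ι : Type*} (s : Finset ι) (F : ι → List R → ℝ) (n : ℕ) (h : List R) :
    treeExp p n (fun z => ∑ i ∈ s, F i z) h = ∑ i ∈ s, treeExp p n (F i) h := by
  induction n generalizing h with
  | zero => rfl
  | succ n ih =>
    simp only [treeExp, ih, Finset.mul_sum]
    exact Finset.sum_comm

theorem treeExp_append_length (n m : ℕ) (F : List R → ℝ) (h : List R) :
    treeExp p (n + m) F h = treeExp p n (treeExp p m F) h := by
  induction n generalizing h with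
  | zero => simp [treeExp]
  | succ n ih => rw [Nat.succ_add]; simp only [treeExp, ih]

/-- A function of the first `n` symbols has the same expectation after more symbols. -/
theorem treeExp_take (hp : ∀ h, ∑ r, p h r = 1) {n N : ℕ} (hn : n ≤ N) (F : List R → ℝ) :
    treeExp p N (fun z => F (z.take n)) [] = treeExp p n F [] := by
  obtain ⟨m, rfl⟩ := Nat.exists_eq_add_of_le hn
  rw [treeExp_append_length]
  refine treeExp_congr n [] fun l hl => ?_
  rw [← treeExp_const hp (F ([] ++ l)) m ([] ++ l)]
  refine treeExp_congr m _ fun l' _ => ?_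
  rw [List.nil_append, List.take_append_of_le_length hl.ge, List.take_of_length_le hl.le]

theorem sum_treeCost {ι : Type*} (s : Finset ι) (c : ι → List R → ℝ) (n : ℕ) (h : List R) :
    ∑ j ∈ s, treeCost p (c j) n h = treeCost p (fun h => ∑ j ∈ s, c j h) n h := by
  induction n generalizing h with
  | zero => simp [treeCost]
  | succ n ih =>
    simp only [treeCost, Finset.sum_add_distrib]
    rw [Finset.sum_comm]
    simp only [← Finset.mul_sum, ih]

theorem treeCost_le (hp : ∀ h r, 0 ≤ p h r) (hp1 : ∀ h, ∑ r, p h r = 1) {c : List R → ℝ} {θ : ℝ}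
    (hc : ∀ h, c h ≤ θ) (n : ℕ) (h : List R) : treeCost p c n h ≤ n * θ := by
  induction n generalizing h with
  | zero => simp [treeCost]
  | succ n ih =>
    have : ∑ r, p h r * treeCost p c n (h ++ [r]) ≤ ∑ r, p h r * (n * θ) :=
      Finset.sum_le_sum fun r _ => mul_le_mul_of_nonneg_left (ih _) (hp h r)
    rw [← Finset.sum_mul, hp1, one_mul] at this
    simp only [treeCost]
    push_cast
    linarith [hc h]

/-- The Gibbs variational inequality on a finite type. -/
theorem exp_neg_le_sum_mul_exp_neg {a b : R → ℝ} (ha : ∀ r, 0 ≤ a r) (ha1 : ∑ r, a r = 1)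
    (hb : ∀ r, 0 ≤ b r) (hab : ∀ r, b r = 0 → a r = 0) (v : R → ℝ) :
    Real.exp (-(∑ r, a r * v r + ∑ r, a r * Real.log (a r / b r)))
      ≤ ∑ r, b r * Real.exp (-v r) := by
  have key := convexOn_exp.map_sum_le (t := Finset.univ) (w := a)
    (p := fun r => -(v r + Real.log (a r / b r))) (fun r _ => ha r) ha1 (fun _ _ => mem_univ _)
  simp only [smul_eq_mul] at key
  have e : ∑ r, a r * -(v r + Real.log (a r / b r))
      = -(∑ r, a r * v r + ∑ r, a r * Real.log (a r / b r)) := by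
    rw [← Finset.sum_add_distrib, ← Finset.sum_neg_distrib]
    exact Finset.sum_congr rfl fun r _ => by ring
  rw [e] at key
  refine key.trans (Finset.sum_le_sum fun r _ => ?_)
  rcases (ha r).eq_or_lt with h0 | h0
  · rw [← h0, zero_mul]
    exact mul_nonneg (hb r) (Real.exp_pos _).le
  · have hbr : 0 < b r := lt_of_le_of_ne (hb r) fun h => h0.ne' (hab r h.symm)
    rw [neg_add, Real.exp_add, Real.exp_neg (Real.log _), Real.exp_log (div_pos h0 hbr)]
    apply le_of_eq
    field_simp

/-- This is the chain rule for relative entropy in variational form: the one-step Gibbs inequality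
is applied at every node, with the exponent accumulated in the subtree as its test function. -/
theorem exp_neg_le_treeExp_exp_neg (hp : ∀ h r, 0 ≤ p h r) (hp1 : ∀ h, ∑ r, p h r = 1)
    (hq : ∀ h r, 0 ≤ q h r) (hpq : ∀ h r, q h r = 0 → p h r = 0) {c : List R → ℝ}
    (hc : ∀ h, ∑ r, p h r * Real.log (p h r / q h r) ≤ c h) (F : List R → ℝ) (n : ℕ)
    (h : List R) :
    Real.exp (-(treeExp p n F h + treeCost p c n h)) ≤ treeExp q n (fun z => Real.exp (-F z)) h := by
  induction n generalizing h with
  | zero => simp [treeExp, treeCost]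
  | succ n ih =>
    have h1 := exp_neg_le_sum_mul_exp_neg (hp h) (hp1 h) (hq h) (hpq h)
      fun r => treeExp p n F (h ++ [r]) + treeCost p c n (h ++ [r])
    have h2 : ∑ r, q h r * Real.exp (-(treeExp p n F (h ++ [r]) + treeCost p c n (h ++ [r])))
        ≤ treeExp q (n + 1) (fun z => Real.exp (-F z)) h :=
      Finset.sum_le_sum fun r _ => mul_le_mul_of_nonneg_left (ih _) (hq h r)
    refine (Real.exp_le_exp.2 ?_).trans (h1.trans h2)
    simp only [treeExp, treeCost, mul_add, Finset.sum_add_distrib]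
    linarith [hc h]

/-- The reason is `(1 + x + x ^ 2 / 2) * (1 - x + x ^ 2 / 2) = 1 + x ^ 4 / 4 ≥ 1`. -/
theorem exp_neg_le_one_sub_add_sq {x : ℝ} (hx : 0 ≤ x) : Real.exp (-x) ≤ 1 - x + x ^ 2 / 2 := by
  rw [Real.exp_neg]
  have h := Real.quadratic_le_exp_of_nonneg hx
  have h1 : 0 < 1 - x + x ^ 2 / 2 := by nlinarith [sq_nonneg (x - 1)]
  rw [inv_le_comm₀ (Real.exp_pos x) h1]
  refine le_trans ?_ h
  rw [inv_le_iff_one_le_mul₀ h1]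
  nlinarith [sq_nonneg (x ^ 2)]

/-- The variational inequality is used with `F = T / 4`. Linearizing both exponentials leaves a
quadratic error `1 / 32`, which becomes `1 / 8` after multiplication by `4`. -/
theorem treeExp_sub_le (hp : ∀ h r, 0 ≤ p h r) (hp1 : ∀ h, ∑ r, p h r = 1)
    (hq : ∀ h r, 0 ≤ q h r) (hq1 : ∀ h, ∑ r, q h r = 1) (hpq : ∀ h r, q h r = 0 → p h r = 0)
    {c : List R → ℝ} (hc : ∀ h, ∑ r, p h r * Real.log (p h r / q h r) ≤ c h) {T : List R → ℝ}
    (hT : ∀ z, T z ∈ Icc (0 : ℝ) 1) (n : ℕ) (h : List R) :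
    treeExp q n T h - 1 / 8 - 4 * treeCost p c n h ≤ treeExp p n T h := by
  have h1 := exp_neg_le_treeExp_exp_neg hp hp1 hq hpq hc (fun z => 1 / 4 * T z) n h
  have h2 : treeExp q n (fun z => Real.exp (-(1 / 4 * T z))) h
      ≤ treeExp q n (fun z => 33 / 32 + -(1 / 4) * T z) h := by
    refine treeExp_mono hq n h fun l _ => ?_
    have := hT (h ++ l)
    have h3 := exp_neg_le_one_sub_add_sq (x := 1 / 4 * T (h ++ l)) (by linarith [this.1])
    nlinarith [this.1, this.2]
  rw [treeExp_add, treeExp_const hq1, treeExp_const_mul] at h2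
  rw [treeExp_const_mul] at h1
  have h4 := Real.add_one_le_exp (-(1 / 4 * treeExp p n T h + treeCost p c n h))
  linarith

end Tree

/-! ### Assouad's lemma for adaptive observations -/

/-- The bit vector `σ` with bit `j` flipped. -/
def flipBit {J : Type*} [DecidableEq J] (j : J) (σ : J → Bool) : J → Bool :=
  Function.update σ j (!σ j)

theorem flipBit_involutive {J : Type*} [DecidableEq J] (j : J) :
    Function.Involutive (flipBit j) := by
  intro σ
  simp [flipBit]

theorem sum_flipBit {J : Type*} [DecidableEq J] [Fintype J] (j : J) (F : (J → Bool) → ℝ) :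
    ∑ σ, F (flipBit j σ) = ∑ σ, F σ :=
  Equiv.sum_comp (flipBit_involutive j).toPerm F

/-- A lower bound, in the style of Assouad's lemma, for the mean number of errors when `σ` is
estimated after `n` adaptive observations. -/
theorem le_sum_sum_treeExp {R J : Type*} [Fintype R] [Fintype J] [DecidableEq J]
    {p : (J → Bool) → List R → R → ℝ} (hp : ∀ σ h r, 0 ≤ p σ h r) (hp1 : ∀ σ h, ∑ r, p σ h r = 1)
    {c : J → List R → ℝ} {θ : ℝ} (hθ : ∀ h, ∑ j, c j h ≤ θ)
    (hc : ∀ σ j h, ∑ r, p σ h r *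
      Real.log (p σ h r / ((p σ h r + p (flipBit j σ) h r) / 2)) ≤ c j h)
    {T : J → Bool → List R → ℝ} (hT : ∀ j b z, T j b z ∈ Icc (0 : ℝ) 1)
    (hT1 : ∀ j z, 1 ≤ T j true z + T j false z) (n : ℕ) (h : List R) :
    Fintype.card (J → Bool) * (3 / 8 * Fintype.card J - 4 * (n * θ))
      ≤ ∑ σ, treeExp (p σ) n (fun z => ∑ j, T j (σ j) z) h := by
  have key : ∀ j σ, 3 / 4 - 4 * (treeCost (p σ) (c j) n h + treeCost (p (flipBit j σ)) (c j) n h)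
      ≤ treeExp (p σ) n (T j (σ j)) h
        + treeExp (p (flipBit j σ)) n (T j (flipBit j σ j)) h := by
    intro j σ
    -- Both laws are compared with their mixture rather than with each other: they are absolutely
    -- continuous with respect to it even when labels are noiseless (`C = 1`, `β = 0`). Under the
    -- mixture the two tests add up to at least `1`, and each comparison loses `1 / 8`, hence the `3
    -- / 4`.
    set q : List R → R → ℝ := fun h r => (p σ h r + p (flipBit j σ) h r) / 2 with hqdef
    have hq : ∀ h r, 0 ≤ q h r := fun h r => by
      have := hp σ h r
      have := hp (flipBit j σ) h r
      simp only [hqdef]; linarith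
    have hq1 : ∀ h, ∑ r, q h r = 1 := fun h => by
      simp only [hqdef, ← Finset.sum_div, Finset.sum_add_distrib, hp1]; norm_num
    have z1 : ∀ h r, q h r = 0 → p σ h r = 0 := fun h r h0 => by
      have := hp σ h r
      have := hp (flipBit j σ) h r
      simp only [hqdef] at h0; linarith
    have z2 : ∀ h r, q h r = 0 → p (flipBit j σ) h r = 0 := fun h r h0 => by
      have := hp σ h r
      have := hp (flipBit j σ) h r
      simp only [hqdef] at h0; linarith
    have a1 := treeExp_sub_le (hp σ) (hp1 σ) hq hq1 z1 (hc σ j) (hT j (σ j)) n h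
    have a2 := treeExp_sub_le (hp (flipBit j σ)) (hp1 (flipBit j σ)) hq hq1 z2 (c := c j)
      (fun h => by
        have := hc (flipBit j σ) j h
        rw [flipBit_involutive j σ] at this
        simpa only [hqdef, add_comm] using this) (hT j (flipBit j σ j)) n h
    have a3 : 1 ≤ treeExp q n (T j (σ j)) h + treeExp q n (T j (flipBit j σ j)) h := by
      rw [← treeExp_add, ← treeExp_const hq1 1 n h]
      refine treeExp_mono hq n h fun l _ => ?_
      have := hT1 j (h ++ l)
      simp only [flipBit, Function.update_self]
      cases σ j <;> simp <;> linarith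
    linarith
  have key2 : ∀ j, 3 / 8 * (Fintype.card (J → Bool) : ℝ) - 4 * ∑ σ, treeCost (p σ) (c j) n h
      ≤ ∑ σ, treeExp (p σ) n (T j (σ j)) h := by
    intro j
    -- Flipping bit `j` permutes the bit vectors, so both halves of `key` have the same sum over
    -- `σ`, and `3 / 4` becomes `3 / 8`.
    have := Finset.sum_le_sum fun σ (_ : σ ∈ Finset.univ) => key j σ
    rw [Finset.sum_add_distrib, sum_flipBit j fun σ => treeExp (p σ) n (T j (σ j)) h,
      Finset.sum_sub_distrib, ← Finset.mul_sum, Finset.sum_add_distrib,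
      sum_flipBit j fun σ => treeCost (p σ) (c j) n h] at this
    simp only [Finset.sum_const, Finset.card_univ, nsmul_eq_mul] at this
    linarith
  have key3 := Finset.sum_le_sum fun j (_ : j ∈ Finset.univ) => key2 j
  rw [Finset.sum_sub_distrib, ← Finset.mul_sum, ← Finset.mul_sum, Finset.sum_comm,
    Finset.sum_comm (f := fun j σ => treeExp (p σ) n (T j (σ j)) h)] at key3
  simp only [sum_treeCost, ← treeExp_sum] at key3
  have hcost : ∑ σ, treeCost (p σ) (fun h => ∑ j, c j h) n h
      ≤ Fintype.card (J → Bool) * (n * θ) := by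
    refine (Finset.sum_le_card_nsmul _ _ (n * θ) fun σ _ =>
      treeCost_le (hp σ) (hp1 σ) hθ n h).trans ?_
    rw [nsmul_eq_mul, Finset.card_univ]
  simp only [Finset.sum_const, Finset.card_univ, nsmul_eq_mul] at key3
  linarith

/-- If a success entails that at most a sixteenth of the bits is wrong, then few observations
give a mean probability of success of at most `11 / 15`. -/
theorem sum_treeExp_le {R J : Type*} [Fintype R] [Fintype J] [DecidableEq J]
    {p : (J → Bool) → List R → R → ℝ} (hp : ∀ σ h r, 0 ≤ p σ h r) (hp1 : ∀ σ h, ∑ r, p σ h r = 1)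
    {c : J → List R → ℝ} {θ : ℝ} (hθ : ∀ h, ∑ j, c j h ≤ θ)
    (hc : ∀ σ j h, ∑ r, p σ h r *
      Real.log (p σ h r / ((p σ h r + p (flipBit j σ) h r) / 2)) ≤ c j h)
    {T : J → Bool → List R → ℝ} (hT : ∀ j b z, T j b z ∈ Icc (0 : ℝ) 1)
    (hT1 : ∀ j z, 1 ≤ T j true z + T j false z) {n : ℕ}
    {S : (J → Bool) → List R → ℝ}
    (hS : ∀ σ z, 15 / 16 * Fintype.card J * S σ z + ∑ j, T j (σ j) z ≤ Fintype.card J)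
    (hJ : 0 < Fintype.card J) (hn : n * θ ≤ Fintype.card J / 64) :
    ∑ σ, treeExp (p σ) n (S σ) [] ≤ Fintype.card (J → Bool) * (11 / 15) := by
  have h1 := le_sum_sum_treeExp hp hp1 hθ hc hT hT1 n []
  have h2 : ∀ σ, 15 / 16 * Fintype.card J * treeExp (p σ) n (S σ) []
      + treeExp (p σ) n (fun z => ∑ j, T j (σ j) z) [] ≤ Fintype.card J := by
    intro σ
    rw [← treeExp_const_mul, ← treeExp_add]
    exact (treeExp_mono (hp σ) n [] fun l _ => hS σ _).trans_eq (treeExp_const (hp1 σ) _ n [])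
  have h3 := Finset.sum_le_sum fun σ (_ : σ ∈ Finset.univ) => h2 σ
  rw [Finset.sum_add_distrib, ← Finset.mul_sum, Finset.sum_const, nsmul_eq_mul,
    Finset.card_univ] at h3
  have hA : (0 : ℝ) < Fintype.card (J → Bool) := by exact_mod_cast Fintype.card_pos
  have hJ' : (0 : ℝ) < Fintype.card J := by exact_mod_cast hJ
  set A : ℝ := (Fintype.card (J → Bool) : ℝ)
  set M : ℝ := (Fintype.card J : ℝ)
  set X := ∑ σ, treeExp (p σ) n (S σ) []
  have h4 : A * (4 * (n * θ)) ≤ A * (4 * (M / 64)) := by gcongr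
  -- The wrong bits make up at least `3 / 8 - 4 / 64 = 5 / 16` of all on average, and the remaining
  -- `11 / 16` equals `15 / 16 * (11 / 15)`.
  have h5 : M * (15 / 16 * X) ≤ M * (15 / 16 * (A * (11 / 15))) := by linarith
  linarith [le_of_mul_le_mul_left h5 hJ']

/-! ### Information in a single answer -/

/-- The probabilities of the answers if an answer other than `⊥` is given with probability `a`,
and is then different from `b` with probability `ν`. -/
noncomputable def answerProb (a ν : ℝ) (b : Bool) : Response → ℝ
  | none => 1 - a
  | some c => a * (if c = b then 1 - ν else ν)

theorem answerProb_nonneg {a ν : ℝ} (ha : a ∈ Icc (0 : ℝ) 1) (hν : ν ∈ Icc (0 : ℝ) 1) (b : Bool)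
    (r : Response) : 0 ≤ answerProb a ν b r := by
  obtain ⟨h1, h2⟩ := ha
  obtain ⟨h3, h4⟩ := hν
  rcases r with _ | c
  · simpa [answerProb] using h2
  · simp only [answerProb]
    split <;> apply mul_nonneg <;> linarith

theorem sum_answerProb (a ν : ℝ) (b : Bool) : ∑ r, answerProb a ν b r = 1 := by
  rw [Fintype.sum_option, Fintype.sum_bool]
  cases b <;> simp [answerProb] <;> ring

theorem mul_log_div_le {x y : ℝ} (hx : 0 ≤ x) (hy : 0 ≤ y) (hxy : y = 0 → x = 0) :
    x * Real.log (x / y) ≤ x * (x / y - 1) := by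
  rcases hx.eq_or_lt with h | h
  · simp [← h]
  · have : 0 < y := lt_of_le_of_ne hy fun h0 => h.ne' (hxy h0.symm)
    exact mul_le_mul_of_nonneg_left (Real.log_le_sub_one_of_pos (div_pos h this)) hx

/-- The information about the label in an answer. -/
theorem sum_answerProb_mul_log_le {a q : ℝ} (ha : a ∈ Icc (0 : ℝ) 1) (hq : q ∈ Icc (0 : ℝ) 1)
    (b b' : Bool) :
    ∑ r, answerProb a (1 / 2 * (1 - q)) b r * Real.log (answerProb a (1 / 2 * (1 - q)) b r /
      ((answerProb a (1 / 2 * (1 - q)) b r + answerProb a (1 / 2 * (1 - q)) b' r) / 2))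
      ≤ a * q ^ 2 := by
  have hν : 1 / 2 * (1 - q) ∈ Icc (0 : ℝ) 1 := ⟨by linarith [hq.2], by linarith [hq.1]⟩
  have hp := answerProb_nonneg ha hν
  -- The bound `log x ≤ x - 1` replaces relative entropy by the chi-square divergence. Abstention
  -- has the same probability under both laws and contributes nothing; the labels contribute exactly
  -- `a * q ^ 2` when they differ.
  refine (Finset.sum_le_sum fun r _ => mul_log_div_le (hp b r)
    (by linarith [hp b r, hp b' r]) fun h => by linarith [hp b r, hp b' r]).trans ?_
  rcases ha.1.eq_or_lt with h0 | h0
  · rw [Fintype.sum_option, Fintype.sum_bool, ← h0]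
    simp [answerProb]
  · rcases eq_or_ne b b' with rfl | hb
    · refine (Finset.sum_nonpos fun r _ => ?_).trans (by positivity)
      refine mul_nonpos_of_nonneg_of_nonpos (hp b r) ?_
      rw [add_self_div_two, sub_nonpos]
      exact div_self_le_one _
    · have hnone : answerProb a (1 / 2 * (1 - q)) b none *
          (answerProb a (1 / 2 * (1 - q)) b none /
          ((answerProb a (1 / 2 * (1 - q)) b none + answerProb a (1 / 2 * (1 - q)) b' none) / 2) - 1)
          ≤ 0 := by
        simp only [answerProb, add_self_div_two]
        exact mul_nonpos_of_nonneg_of_nonpos (by linarith [ha.2])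
          (by linarith [div_self_le_one (1 - a)])
      rw [Fintype.sum_option, Fintype.sum_bool]
      have hsome : ∀ x y : ℝ, x + y = 1 → (2 * x - 1) ^ 2 = q ^ 2 →
          a * x * (a * x / ((a * x + a * y) / 2) - 1)
          + a * y * (a * y / ((a * y + a * x) / 2) - 1) = a * q ^ 2 := by
        intro x y hxy hx
        obtain rfl : y = 1 - x := by linarith
        have e1 : a * x + a * (1 - x) = a := by ring
        have e2 : a * (1 - x) + a * x = a := by ring
        rw [e1, e2, ← hx]
        field_simp
        ring
      refine (add_le_add_left hnone _).trans ?_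
      cases b <;> cases b' <;> simp at hb
      · simp only [answerProb, reduceCtorEq, if_false, if_true, zero_add]
        exact (hsome _ _ (by ring) (by ring)).le
      · simp only [answerProb, reduceCtorEq, if_false, if_true, zero_add]
        exact (hsome _ _ (by ring) (by ring)).le

/-- `answerProb` as a probability mass function. -/
noncomputable def answerPMF {a ν : ℝ} (ha : a ∈ Icc (0 : ℝ) 1) (hν : ν ∈ Icc (0 : ℝ) 1)
    (b : Bool) : PMF Response :=
  PMF.ofFintype (fun r => ENNReal.ofReal (answerProb a ν b r)) <| by
    rw [← ENNReal.ofReal_sum_of_nonneg fun r _ => answerProb_nonneg ha hν b r, sum_answerProb,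
      ENNReal.ofReal_one]

theorem toReal_answerPMF {a ν : ℝ} (ha : a ∈ Icc (0 : ℝ) 1) (hν : ν ∈ Icc (0 : ℝ) 1) (b : Bool)
    (r : Response) : (answerPMF ha hν b r).toReal = answerProb a ν b r := by
  rw [answerPMF, PMF.ofFintype_apply, ENNReal.toReal_ofReal (answerProb_nonneg ha hν b r)]

/-! ### The labeler and its two conditions -/

/-- The corner `0` of the cube. -/
def cubeZero (k : ℕ) : Cube k := ⟨0, fun _ => ⟨le_rfl, zero_le_one⟩⟩

/-- The height of the zone above the bottom of `[0,1]^(k+1)` where the labeler with ground truth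
`g` is least informative. -/
noncomputable def zoneHeight {k : ℕ} (g : Cube k → ℝ) : ℝ :=
  open Classical in
  if (∀ x, g x ≤ 2 * g (cubeZero k)) ∧ 4 * g (cubeZero k) ∈ Icc (0 : ℝ) 1
    then 4 * g (cubeZero k) else 1

theorem zoneHeight_mem_Icc {k : ℕ} (g : Cube k → ℝ) : zoneHeight g ∈ Icc (0 : ℝ) 1 := by
  unfold zoneHeight
  split
  · next h => exact h.2
  · simp

/-- Either the zone is the whole column, or the boundary stays in its lower half; then a point above
the zone is farther from the boundary than every point below it in the column. Only this dichotomy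
enters the verification of the conditions. -/
theorem zoneHeight_eq_one_or {k : ℕ} (g : Cube k → ℝ) :
    zoneHeight g = 1 ∨ ∀ x, 2 * g x ≤ zoneHeight g := by
  unfold zoneHeight
  split
  · next h => exact Or.inr fun x => by linarith [h.1 x]
  · simp

/-- The rate at which a wrong label is given: constant in the zone, and `0` above it. -/
noncomputable def zoneNoise (C β H t : ℝ) : ℝ := if t ≤ H then 1 / 2 * (1 - C * H ^ β) else 0

theorem mul_rpow_mem_Icc {C β H : ℝ} (hC : C ∈ Icc (0 : ℝ) 1) (hβ : 0 ≤ β)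
    (hH : H ∈ Icc (0 : ℝ) 1) : C * H ^ β ∈ Icc (0 : ℝ) 1 :=
  ⟨mul_nonneg hC.1 (Real.rpow_nonneg hH.1 β),
    mul_le_one₀ hC.2 (Real.rpow_nonneg hH.1 β) (Real.rpow_le_one hH.1 hH.2 hβ)⟩

theorem zoneNoise_mem_Icc {C β H : ℝ} (hC : C ∈ Icc (0 : ℝ) 1) (hβ : 0 ≤ β)
    (hH : H ∈ Icc (0 : ℝ) 1) (t : ℝ) : zoneNoise C β H t ∈ Icc (0 : ℝ) 1 := by
  have := mul_rpow_mem_Icc hC hβ hH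
  unfold zoneNoise
  split
  · exact ⟨by linarith [this.2], by linarith [this.1]⟩
  · simp

theorem max_mem_Icc {H t : ℝ} (hH : H ∈ Icc (0 : ℝ) 1) (ht : t ∈ Icc (0 : ℝ) 1) :
    max H t ∈ Icc (0 : ℝ) 1 := ⟨le_max_of_le_left hH.1, max_le hH.2 ht.2⟩

section Labeler

variable {k : ℕ} {f : ℝ → ℝ} {C β : ℝ}

/-- The response law in which the abstention rate does not depend on the boundary, other than
through the height `zoneHeight` of the zone. -/
noncomputable def zoneLaw (hf : MonotoneOn f (Icc 0 1)) (hf' : MapsTo f (Icc 0 1) (Icc 0 1))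
    (hC : C ∈ Icc (0 : ℝ) 1) (hβ : 0 ≤ β) (g : Cube k → ℝ) (hg : Measurable g) :
    ResponseLaw k where
  prob x := answerPMF (hf' (max_mem_Icc (zoneHeight_mem_Icc g) x.2.2))
    (zoneNoise_mem_Icc hC hβ (zoneHeight_mem_Icc g) x.2) (trueLabel g x)
  measurable_prob y := by
    have h1 : Measurable fun t : ↥(Icc (0 : ℝ) 1) => f (max (zoneHeight g) t) := by
      refine Monotone.measurable fun s t hst => hf (max_mem_Icc (zoneHeight_mem_Icc g) s.2)
        (max_mem_Icc (zoneHeight_mem_Icc g) t.2) (max_le_max le_rfl hst)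
    have h2 : Measurable fun x : Instance k => f (max (zoneHeight g) x.2) := h1.comp measurable_snd
    have h3 : Measurable fun x : Instance k => zoneNoise C β (zoneHeight g) x.2 := by
      unfold zoneNoise
      exact Measurable.ite (measurableSet_le (by fun_prop) measurable_const)
        measurable_const measurable_const
    have h4 : ∀ c, MeasurableSet {x : Instance k | c = trueLabel g x} := by
      have h5 : MeasurableSet {x : Instance k | g x.1 < x.2} :=
        measurableSet_lt (by fun_prop) (by fun_prop)
      have h6 : MeasurableSet {x : Instance k | x.2 ≤ g x.1} :=
        measurableSet_le (by fun_prop) (by fun_prop)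
      rintro (_ | _)
      · simpa [trueLabel, eq_comm] using h6
      · simpa [trueLabel, eq_comm] using h5
    simp only [answerPMF, PMF.ofFintype_apply]
    refine Measurable.ennreal_ofReal ?_
    rcases y with _ | c
    · exact h2.const_sub 1
    · exact h2.mul (Measurable.ite (h4 c) (h3.const_sub 1) h3)

theorem toReal_zoneLaw_prob (hf : MonotoneOn f (Icc 0 1)) (hf' : MapsTo f (Icc 0 1) (Icc 0 1))
    (hC : C ∈ Icc (0 : ℝ) 1) (hβ : 0 ≤ β) (g : Cube k → ℝ) (hg : Measurable g) (x : Instance k)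
    (r : Response) :
    ((zoneLaw hf hf' hC hβ g hg).prob x r).toReal =
      answerProb (f (max (zoneHeight g) x.2)) (zoneNoise C β (zoneHeight g) x.2)
        (trueLabel g x) r :=
  by
  rw [zoneLaw, toReal_answerPMF]

theorem abstainRate_zoneLaw (hf : MonotoneOn f (Icc 0 1)) (hf' : MapsTo f (Icc 0 1) (Icc 0 1))
    (hC : C ∈ Icc (0 : ℝ) 1) (hβ : 0 ≤ β) (g : Cube k → ℝ) (hg : Measurable g) (x : Instance k) :
    (zoneLaw hf hf' hC hβ g hg).abstainRate x = 1 - f (max (zoneHeight g) x.2) :=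
  toReal_zoneLaw_prob hf hf' hC hβ g hg x none

theorem noiseRate_zoneLaw (hf : MonotoneOn f (Icc 0 1)) (hf' : MapsTo f (Icc 0 1) (Icc 0 1))
    (hC : C ∈ Icc (0 : ℝ) 1) (hβ : 0 ≤ β) (g : Cube k → ℝ) (hg : Measurable g) (x : Instance k)
    (hx : (zoneLaw hf hf' hC hβ g hg).abstainRate x ≠ 1) :
    (zoneLaw hf hf' hC hβ g hg).noiseRate g x = zoneNoise C β (zoneHeight g) x.2 := by
  rw [abstainRate_zoneLaw] at hx
  have h0 : f (max (zoneHeight g) x.2) ≠ 0 := fun h => hx (by rw [h, sub_zero])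
  rw [ResponseLaw.noiseRate, toReal_zoneLaw_prob, toReal_zoneLaw_prob, toReal_zoneLaw_prob]
  cases trueLabel g x <;> simp [answerProb] <;> field_simp <;> ring

theorem boundaryDist_le_max {g : Cube k → ℝ} (hg : ∀ x, g x ∈ Icc (0 : ℝ) 1) (x : Instance k) :
    boundaryDist g x ≤ max (zoneHeight g) x.2 := by
  have h1 := hg x.1
  have h2 := x.2.2
  rw [boundaryDist, abs_le]
  refine ⟨?_, le_max_of_le_right (by linarith [h1.1])⟩
  rcases zoneHeight_eq_one_or g with h | h
  · rw [h]; linarith [h1.2, h2.1, le_max_left (1 : ℝ) x.2]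
  · linarith [h x.1, h1.1, h2.1, le_max_left (zoneHeight g) x.2]

/-- In the zone the distance to the boundary is at most the zone height, so the constant noise there
is below the permitted one. Above the zone labels are correct. -/
theorem zoneNoise_le (hC : C ∈ Icc (0 : ℝ) 1) (hβ : 0 ≤ β) {g : Cube k → ℝ}
    (hg : ∀ x, g x ∈ Icc (0 : ℝ) 1) (x : Instance k) :
    zoneNoise C β (zoneHeight g) x.2 ≤ 1 / 2 * (1 - C * boundaryDist g x ^ β) := by
  have h0 : 0 ≤ boundaryDist g x := abs_nonneg _
  have hle := boundaryDist_le_max hg x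
  have hH := zoneHeight_mem_Icc g
  unfold zoneNoise
  split
  · next h =>
    rw [max_eq_left h] at hle
    have := mul_le_mul_of_nonneg_left (Real.rpow_le_rpow h0 hle hβ) hC.1
    linarith
  · have := mul_rpow_mem_Icc hC hβ ⟨h0, hle.trans (max_mem_Icc hH x.2.2).2⟩
    linarith [this.2]

theorem monotoneAbstention_zoneLaw (hf : MonotoneOn f (Icc 0 1))
    (hf' : MapsTo f (Icc 0 1) (Icc 0 1)) (hC : C ∈ Icc (0 : ℝ) 1) (hβ : 0 ≤ β) {g : Cube k → ℝ}
    (hm : Measurable g) (hg : ∀ x, g x ∈ Icc (0 : ℝ) 1) :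
    MonotoneAbstention g (zoneLaw hf hf' hC hβ g hm) where
  abstention x t t' h := by
    rw [abstainRate_zoneLaw, abstainRate_zoneLaw]
    have hH := zoneHeight_mem_Icc g
    refine sub_le_sub_left (hf (max_mem_Icc hH t'.2) (max_mem_Icc hH t.2) ?_) 1
    refine max_le (le_max_left _ _) ?_
    -- Otherwise `t'` would be above both the zone and `t`, hence strictly farther from the boundary
    -- than `t`.
    by_contra! hlt
    obtain ⟨h1, h2⟩ := max_lt_iff.1 hlt
    rcases zoneHeight_eq_one_or g with h3 | h3
    · linarith [t'.2.2]
    · simp only [boundaryDist] at h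
      have h4 := h3 x
      have h5 := (hg x).1
      have h6 := t.2.1
      rw [abs_of_nonneg (by linarith : 0 ≤ (t' : ℝ) - g x)] at h
      rcases abs_cases ((t : ℝ) - g x) with ⟨h7, -⟩ | ⟨h7, -⟩ <;> linarith
  noise x hx := by
    rw [noiseRate_zoneLaw hf hf' hC hβ g hm x hx]
    refine (zoneNoise_le hC hβ hg x).trans ?_
    have : 0 ≤ C * boundaryDist g x ^ β := mul_nonneg hC.1 (Real.rpow_nonneg (abs_nonneg _) β)
    linarith

theorem boundedNoise_zoneLaw (hf : MonotoneOn f (Icc 0 1))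
    (hf' : MapsTo f (Icc 0 1) (Icc 0 1)) (hC : C ∈ Icc (0 : ℝ) 1) (hβ : 0 ≤ β) {g : Cube k → ℝ}
    (hm : Measurable g) (hg : ∀ x, g x ∈ Icc (0 : ℝ) 1) :
    BoundedNoise f C β g (zoneLaw hf hf' hC hβ g hm) where
  abstention x := by
    rw [abstainRate_zoneLaw]
    have hm' := max_mem_Icc (zoneHeight_mem_Icc g) x.2.2
    have hle := boundaryDist_le_max hg x
    exact sub_le_sub_left (hf ⟨abs_nonneg _, hle.trans hm'.2⟩ hm' hle) 1
  noise x hx := by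
    rw [noiseRate_zoneLaw hf hf' hC hβ g hm x hx]
    exact zoneNoise_le hC hβ hg x

/-- The labeler that answers with `zoneLaw` (if the ground truth is measurable). -/
noncomputable def zoneLabeler (k : ℕ) (hf : MonotoneOn f (Icc 0 1))
    (hf' : MapsTo f (Icc 0 1) (Icc 0 1)) (hC : C ∈ Icc (0 : ℝ) 1) (hβ : 0 ≤ β) : Labeler k :=
  open Classical in
  fun g => if hg : Measurable g then zoneLaw hf hf' hC hβ g hg
    else ⟨fun _ => PMF.pure none, fun _ => measurable_const⟩

theorem zoneLabeler_of_measurable (hf : MonotoneOn f (Icc 0 1))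
    (hf' : MapsTo f (Icc 0 1) (Icc 0 1)) (hC : C ∈ Icc (0 : ℝ) 1) (hβ : 0 ≤ β) {g : Cube k → ℝ}
    (hg : Measurable g) : zoneLabeler k hf hf' hC hβ g = zoneLaw hf hf' hC hβ g hg :=
  dif_pos hg

theorem IsHolderSmooth.measurable {K γ : ℝ} {g : Cube k → ℝ} (hg : IsHolderSmooth K γ g) :
    Measurable g := by
  have h := continuousOn_iff_continuous_domRestrict.1 hg.1.continuousOn
  have e : (unitCube k).domRestrict (Function.extend Subtype.val g 0) = g :=
    funext fun x => Subtype.val_injective.extend_apply g 0 x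
  rw [e] at h
  exact h.measurable

end Labeler

/-! ### Success probability as an expectation over the answer tree -/

theorem sum_ofFn_succ {R M : Type*} [Fintype R] [AddCommMonoid M] (n : ℕ) (F : List R → M) :
    ∑ y : Fin (n + 1) → R, F (List.ofFn y) = ∑ y : Fin n → R, ∑ r, F (List.ofFn y ++ [r]) := by
  rw [← (Fin.snocEquiv fun _ => R).sum_comp, Fintype.sum_prod_type, Finset.sum_comm]
  refine Finset.sum_congr rfl fun y _ => Finset.sum_congr rfl fun r _ => ?_
  rw [List.ofFn_succ']
  simp [Fin.snocEquiv]

theorem treeExp_nonneg {R : Type*} [Fintype R] {p : List R → R → ℝ} (hp : ∀ h r, 0 ≤ p h r)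
    {F : List R → ℝ} (hF : ∀ z, 0 ≤ F z) (n : ℕ) (h : List R) : 0 ≤ treeExp p n F h := by
  induction n generalizing h with
  | zero => exact hF h
  | succ n ih => exact Finset.sum_nonneg fun r _ => mul_nonneg (hp h r) (ih _)

namespace ActiveLearner

variable {k : ℕ} (A : ActiveLearner k)

theorem transcriptProb_append_singleton (P : ResponseLaw k) (s : A.Ω) (h : List Response)
    (r : Response) :
    A.transcriptProb P s (h ++ [r]) = A.transcriptProb P s h * P.prob (A.query s h) r := by
  have e : ∀ l : List Response, A.transcriptProb P s l
      = ∏ i ∈ Finset.range l.length, P.prob (A.query s (l.take i)) (l.getD i none) := by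
    intro l
    rw [Finset.prod_range]
    exact Finset.prod_congr rfl fun i _ => by simp
  rw [e, e, List.length_append, List.length_singleton, Finset.prod_range_succ]
  congr 1
  · refine Finset.prod_congr rfl fun i hi => ?_
    have hi' := Finset.mem_range.1 hi
    rw [List.take_append_of_le_length hi'.le, List.getD_append _ _ _ _ hi']
  · simp

/-- The law of the answer that follows a history. -/
noncomputable def answerLaw (P : ResponseLaw k) (s : A.Ω) (h : List Response) (r : Response) : ℝ :=
  (P.prob (A.query s h) r).toReal

theorem answerLaw_nonneg (P : ResponseLaw k) (s : A.Ω) (h : List Response) (r : Response) :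
    0 ≤ A.answerLaw P s h r := ENNReal.toReal_nonneg

theorem sum_answerLaw (P : ResponseLaw k) (s : A.Ω) (h : List Response) :
    ∑ r, A.answerLaw P s h r = 1 := by
  have := (P.prob (A.query s h)).tsum_coe
  rw [tsum_fintype] at this
  unfold answerLaw
  rw [← ENNReal.toReal_sum fun r _ => PMF.apply_ne_top _ r, this, ENNReal.toReal_one]

theorem sum_ofReal_mul_transcriptProb (P : ResponseLaw k) (s : A.Ω) {F : List Response → ℝ}
    (hF : ∀ z, 0 ≤ F z) (n : ℕ) :
    ∑ y : Fin n → Response, ENNReal.ofReal (F (List.ofFn y)) * A.transcriptProb P s (List.ofFn y)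
      = ENNReal.ofReal (treeExp (A.answerLaw P s) n F []) := by
  induction n generalizing F with
  | zero =>
    have : A.transcriptProb P s [] = 1 := Fin.prod_univ_zero _
    simp [treeExp, this]
  | succ n ih =>
    -- The transcript product splits off the last answer whereas `treeExp` recurses on the first;
    -- `treeExp_append_length` with one final step reconciles them.
    rw [sum_ofFn_succ n fun z => ENNReal.ofReal (F z) * A.transcriptProb P s z,
      treeExp_append_length]
    rw [← ih fun z => treeExp_nonneg (A.answerLaw_nonneg P s) hF 1 z]
    refine Finset.sum_congr rfl fun y _ => ?_
    simp only [treeExp]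
    rw [ENNReal.ofReal_sum_of_nonneg fun r _ => mul_nonneg (A.answerLaw_nonneg P s _ r) (hF _),
      Finset.sum_mul]
    refine Finset.sum_congr rfl fun r _ => ?_
    rw [transcriptProb_append_singleton, ENNReal.ofReal_mul (A.answerLaw_nonneg P s _ r),
      answerLaw, ENNReal.ofReal_toReal (PMF.apply_ne_top _ _)]
    ring

variable {A}

theorem StopsAt.eq_of_prefix {s : A.Ω} {h h' : List Response} (hs : A.StopsAt s h)
    (hs' : A.StopsAt s h') (hp : h <+: h') : h = h' := by
  rcases hp.length_le.eq_or_lt with h1 | h1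
  · exact hp.eq_of_length h1
  · have := hs'.2 _ h1
    rw [← List.prefix_iff_eq_take.1 hp] at this
    exact absurd hs.1 this

theorem StopsAt.take_eq {s : A.Ω} {z : List Response} {n n' : ℕ} (hs : A.StopsAt s (z.take n))
    (hs' : A.StopsAt s (z.take n')) : z.take n = z.take n' := by
  rcases le_total n n' with h | h
  · exact hs.eq_of_prefix hs' (List.take_prefix_take_left h)
  · exact (hs'.eq_of_prefix hs (List.take_prefix_take_left h)).symm

variable (A)

open Classical in
/-- The probability of success with the seed `s`, as an expectation over `N` answers. -/
theorem sum_stopsAt_le (P : ResponseLaw k) (g : Cube k → ℝ) (ε : ℝ) (N : ℕ) (s : A.Ω) :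
    (∑ n ∈ Finset.range (N + 1), ∑ y : Fin n → Response,
      (if A.StopsAt s (List.ofFn y) ∧
          boundaryError (A.output s (List.ofFn y)) g ≤ ENNReal.ofReal ε
        then A.transcriptProb P s (List.ofFn y) else 0)) ≤
    ENNReal.ofReal (treeExp (A.answerLaw P s) N (fun z =>
      if ∃ n ≤ N, A.StopsAt s (z.take n) ∧
        boundaryError (A.output s (z.take n)) g ≤ ENNReal.ofReal ε then 1 else 0) []) := by
  set Q : List Response → Prop := fun z => A.StopsAt s z ∧
    boundaryError (A.output s z) g ≤ ENNReal.ofReal ε with hQ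
  set F : List Response → ℝ := fun z => if Q z then 1 else 0 with hF
  have hF0 : ∀ z, 0 ≤ F z := fun z => by simp only [hF]; split <;> norm_num
  have h1 : ∀ n ∈ Finset.range (N + 1), (∑ y : Fin n → Response,
      (if Q (List.ofFn y) then A.transcriptProb P s (List.ofFn y) else 0)) =
      ENNReal.ofReal (treeExp (A.answerLaw P s) N (fun z => F (z.take n)) []) := by
    intro n hn
    rw [treeExp_take (A.sum_answerLaw P s) (by simpa [Nat.lt_succ_iff] using hn),
      ← A.sum_ofReal_mul_transcriptProb P s hF0]
    refine Finset.sum_congr rfl fun y _ => ?_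
    simp only [hF]
    split <;> simp
  rw [Finset.sum_congr rfl h1, ← ENNReal.ofReal_sum_of_nonneg fun n _ =>
    treeExp_nonneg (A.answerLaw_nonneg P s) (fun z => hF0 _) N [], ← treeExp_sum]
  refine ENNReal.ofReal_le_ofReal (treeExp_mono (A.answerLaw_nonneg P s) N [] fun z hz => ?_)
  rw [List.nil_append]
  split
  · next h =>
    obtain ⟨n, hn, hn'⟩ := h
    -- The algorithm stops at only one prefix of a given sequence of answers, so the events for
    -- different `n` are disjoint.
    rw [Finset.sum_eq_single n]
    · simp only [hF]; split <;> norm_num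
    · intro n' hn2 hne
      refine if_neg fun h2 => hne ?_
      have := congrArg List.length (h2.1.take_eq hn'.1)
      have := Finset.mem_range.1 hn2
      simp only [List.length_take] at *
      omega
    · intro h2
      exact absurd (Finset.mem_range.2 (by omega)) h2
  · next h =>
    refine (Finset.sum_eq_zero fun n hn => if_neg fun h2 => h ⟨n, ?_, h2⟩).le
    simpa [Nat.lt_succ_iff] using hn

theorem successProb_mono (P : ResponseLaw k) (g : Cube k → ℝ) (ε : ℝ) {N N' : ℕ} (h : N ≤ N') :
    A.successProb P g ε N ≤ A.successProb P g ε N' :=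
  lintegral_mono fun _ => Finset.sum_le_sum_of_subset (Finset.range_mono (by omega))

end ActiveLearner

/-! ### From `L¹` error to wrong bits -/

theorem sum_setLIntegral_le {α J : Type*} [MeasurableSpace α] [Fintype J] (μ : Measure α)
    {cell : J → Set α} (hm : ∀ j, MeasurableSet (cell j))
    (hd : Pairwise (Function.onFun Disjoint cell)) (F : α → ℝ≥0∞) :
    ∑ j, ∫⁻ x in cell j, F x ∂μ ≤ ∫⁻ x, F x ∂μ := by
  rw [← tsum_fintype (L := .unconditional _), ← lintegral_iUnion hm hd]
  exact setLIntegral_le_lintegral _ _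

/-- The families of boundaries with the values `h` or `2h` on the cells, according to `σ`. -/
structure IsCellFamily {k : ℕ} {J : Type*} [Fintype J] (h : ℝ) (cell : J → Set (Cube k))
    (g : (J → Bool) → Cube k → ℝ) : Prop where
  measurableSet_cell : ∀ j, MeasurableSet (cell j)
  disjoint_cell : Pairwise (Function.onFun Disjoint cell)
  volume_cell : ∀ j, ENNReal.ofReal (1 / (2 * Fintype.card J)) ≤ cubeVolume k (cell j)
  apply_eq : ∀ σ j, ∀ x ∈ cell j, g σ x = h * (1 + if σ j then 1 else 0)

/-- The `L¹` distance on a cell of `u` and the value that belongs to the bit `b`. -/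
noncomputable def cellError {k : ℕ} (h : ℝ) (B : Set (Cube k)) (b : Bool) (u : Cube k → ℝ) :
    ℝ≥0∞ :=
  ∫⁻ x in B, ‖u x - h * (1 + if b then 1 else 0)‖ₑ ∂(cubeVolume k)

namespace IsCellFamily

variable {k : ℕ} {J : Type*} [Fintype J] {h : ℝ} {cell : J → Set (Cube k)}
  {g : (J → Bool) → Cube k → ℝ}

/-- The two candidate values differ by `h` on a cell of volume at least `1 / (2 M)`, with `M` the
number of cells. By the triangle inequality no output is closer than `h / (4 M)` to both. -/
theorem le_cellError_add_cellError (hg : IsCellFamily h cell g) (hh : 0 ≤ h) (j : J)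
    {u : Cube k → ℝ} (hu : Measurable u) :
    2 * ENNReal.ofReal (h / (4 * Fintype.card J)) ≤
      cellError h (cell j) true u + cellError h (cell j) false u := by
  have h1 : ENNReal.ofReal h * cubeVolume k (cell j)
      ≤ cellError h (cell j) true u + cellError h (cell j) false u := by
    unfold cellError
    rw [← lintegral_add_left (by fun_prop), ← setLIntegral_const]
    refine lintegral_mono fun x => ?_
    have e : h = (u x - h * (1 + if false then 1 else 0)) - (u x - h * (1 + if true then 1 else 0)) := by
      simp; ring
    calc ENNReal.ofReal h = ‖h‖ₑ := (Real.enorm_of_nonneg hh).symm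
      _ ≤ _ := by
        conv_lhs => rw [e]
        exact enorm_sub_le.trans_eq (add_comm _ _)
  refine le_trans ?_ ((mul_le_mul_right (hg.volume_cell j) (ENNReal.ofReal h)).trans h1)
  rw [← ENNReal.ofReal_mul hh, show (2 : ℝ≥0∞) = ENNReal.ofReal 2 by simp,
    ← ENNReal.ofReal_mul (by norm_num)]
  refine ENNReal.ofReal_le_ofReal (le_of_eq ?_)
  rcases eq_or_ne (Fintype.card J : ℝ) 0 with h0 | h0
  · simp [h0]
  · field_simp; ring

theorem sum_cellError_le (hg : IsCellFamily h cell g) (σ : J → Bool) (u : Cube k → ℝ) :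
    ∑ j, cellError h (cell j) (σ j) u ≤ boundaryError u (g σ) := by
  refine le_trans (le_of_eq (Finset.sum_congr rfl fun j _ => ?_))
    (sum_setLIntegral_le _ hg.measurableSet_cell hg.disjoint_cell _)
  exact setLIntegral_congr_fun (hg.measurableSet_cell j) fun x hx => by
    simp only [hg.apply_eq σ j x hx]

-- A Markov count: at most `ε / (h / (4 M)) = M / 16` cells can have error `h / (4 M)` or more,
-- where `M` is the number of cells. This fixes the ratio `64` between `h` and `ε`.
open Classical in
theorem sum_ite_le_cellError (hg : IsCellFamily h cell g) {ε : ℝ} (hε : 0 < ε) (hh : h = 64 * ε)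
    (σ : J → Bool) {u : Cube k → ℝ} (hu : boundaryError u (g σ) ≤ ENNReal.ofReal ε) :
    ∑ j, (if ENNReal.ofReal (h / (4 * Fintype.card J)) ≤ cellError h (cell j) (σ j) u
      then (1 : ℝ) else 0) ≤ Fintype.card J / 16 := by
  rcases isEmpty_or_nonempty J with hJ | hJ
  · simp
  have hM : (0 : ℝ) < Fintype.card J := by exact_mod_cast Fintype.card_pos
  set t := ENNReal.ofReal (h / (4 * Fintype.card J)) with ht
  set s := Finset.univ.filter fun j => t ≤ cellError h (cell j) (σ j) u with hs
  rw [← Finset.sum_filter, Finset.sum_const, nsmul_eq_mul, mul_one]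
  have h1 : (s.card : ℝ≥0∞) * t ≤ ENNReal.ofReal ε := by
    rw [← nsmul_eq_mul]
    refine (Finset.card_nsmul_le_sum s _ t fun j hj => (Finset.mem_filter.1 hj).2).trans ?_
    refine (Finset.sum_le_sum_of_subset (Finset.subset_univ s)).trans ?_
    exact (hg.sum_cellError_le σ u).trans hu
  rw [ht, ← ENNReal.ofReal_natCast, ← ENNReal.ofReal_mul (Nat.cast_nonneg _),
    ENNReal.ofReal_le_ofReal_iff hε.le, hh, mul_div_assoc', div_le_iff₀ (by positivity)] at h1
  have h2 : ε * (16 * s.card) ≤ ε * Fintype.card J := by linarith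
  linarith [le_of_mul_le_mul_left h2 hε]

end IsCellFamily

open Classical in
/-- If the law of an answer depends on a single bit, about which it carries an information of at
most `θ`, then few queries give a mean probability of success of at most `11 / 15`. -/
theorem ActiveLearner.sum_successProb_le {k : ℕ} {J : Type*} [Fintype J] [DecidableEq J]
    [Nonempty J] (A : ActiveLearner k) {h ε θ : ℝ} {cell : J → Set (Cube k)} {g : (J → Bool) → Cube k → ℝ}
    (hg : IsCellFamily h cell g) (hε : 0 < ε) (hh : h = 64 * ε) {P : (J → Bool) → ResponseLaw k}
    (col : Instance k → J)
    (hc : ∀ σ j x, ∑ r, ((P σ).prob x r).toReal * Real.log (((P σ).prob x r).toReal /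
      ((((P σ).prob x r).toReal + ((P (flipBit j σ)).prob x r).toReal) / 2))
        ≤ if col x = j then θ else 0) {N : ℕ} (hN : N * θ ≤ Fintype.card J / 64) :
    ∑ σ, A.successProb (P σ) (g σ) ε N ≤ ENNReal.ofReal (Fintype.card (J → Bool) * (11 / 15)) := by
  have hh0 : 0 ≤ h := by linarith
  -- Superadditivity of the lower integral suffices and needs no measurability in the seed.
  have hadd : ∀ (s : Finset (J → Bool)) (F : (J → Bool) → A.Ω → ℝ≥0∞),
      ∑ σ ∈ s, ∫⁻ ω, F σ ω ∂A.μ ≤ ∫⁻ ω, ∑ σ ∈ s, F σ ω ∂A.μ := by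
    intro s F
    induction s using Finset.induction_on with
    | empty => simp
    | insert a s ha ih =>
      simp only [Finset.sum_insert ha]
      exact (add_le_add_right ih _).trans (le_lintegral_add _ _)
  unfold ActiveLearner.successProb
  refine (hadd _ _).trans ?_
  refine (lintegral_mono (g := fun _ => ENNReal.ofReal (Fintype.card (J → Bool) * (11 / 15)))
    fun ω => ?_).trans (by simp)
  refine (Finset.sum_le_sum fun σ _ => A.sum_stopsAt_le (P σ) (g σ) ε N ω).trans ?_
  rw [← ENNReal.ofReal_sum_of_nonneg fun σ _ => treeExp_nonneg
    (A.answerLaw_nonneg _ ω) (fun z => by split <;> norm_num) N []]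
  refine ENNReal.ofReal_le_ofReal ?_
  set t := ENNReal.ofReal (h / (4 * Fintype.card J)) with ht
  refine sum_treeExp_le (fun σ => A.answerLaw_nonneg (P σ) ω) (fun σ => A.sum_answerLaw (P σ) ω)
    (c := fun j l => if col (A.query ω l) = j then θ else 0) (θ := θ) (by simp)
    (fun σ j l => hc σ j (A.query ω l))
    -- `T j b` tests whether the output is far from the value of bit `b` on cell `j`. Without a stop
    -- within `N` queries it is vacuously `1` for both bits, which keeps the sum over `b` at least
    -- `1`.
    (T := fun j b z => if ∀ n ≤ N, A.StopsAt ω (z.take n) →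
      t ≤ cellError h (cell j) b (A.output ω (z.take n)) then 1 else 0)
    (fun j b z => by split <;> norm_num) ?_ ?_ Fintype.card_pos hN
  · intro j z
    by_cases h1 : ∀ n ≤ N, A.StopsAt ω (z.take n) →
      t ≤ cellError h (cell j) true (A.output ω (z.take n))
    · rw [if_pos h1]; split <;> norm_num
    · rw [if_neg h1, if_pos, zero_add]
      push Not at h1
      obtain ⟨n, hn, hs, hlt⟩ := h1
      intro n' hn' hs'
      rw [← hs.take_eq hs']
      by_contra! hlt'
      have hm : Measurable (A.output ω (z.take n)) :=
        (A.measurable_output (z.take n)).comp measurable_prodMk_left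
      have := (hg.le_cellError_add_cellError hh0 j hm).trans_lt (ENNReal.add_lt_add hlt hlt')
      rw [two_mul] at this
      exact lt_irrefl _ this
  · intro σ z
    have hM : (0 : ℝ) < Fintype.card J := by exact_mod_cast Fintype.card_pos
    split
    · next h1 =>
      obtain ⟨n, hn, hs, he⟩ := h1
      have h2 : ∑ j, (if ∀ n ≤ N, A.StopsAt ω (z.take n) →
          t ≤ cellError h (cell j) (σ j) (A.output ω (z.take n)) then (1 : ℝ) else 0) ≤
          ∑ j, (if t ≤ cellError h (cell j) (σ j) (A.output ω (z.take n)) then (1 : ℝ) else 0) := by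
        refine Finset.sum_le_sum fun j _ => ?_
        split
        · next h3 => rw [if_pos (h3 n hn hs)]
        · split <;> norm_num
      linarith [hg.sum_ite_le_cellError hε hh σ he]
    · have h2 : ∑ j, (if ∀ n ≤ N, A.StopsAt ω (z.take n) →
          t ≤ cellError h (cell j) (σ j) (A.output ω (z.take n)) then (1 : ℝ) else 0) ≤
          ∑ _j : J, (1 : ℝ) := Finset.sum_le_sum fun j _ => by split <;> norm_num
      simp only [Finset.sum_const, Finset.card_univ, nsmul_eq_mul, mul_one] at h2
      linarith

/-! ### The grid and its family of boundaries -/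

theorem volume_setOf_forall_mem_Icc {k : ℕ} (a b : Fin k → ℝ) :
    volume {x : EuclideanSpace ℝ (Fin k) | ∀ i, x i ∈ Icc (a i) (b i)}
      = ∏ i, ENNReal.ofReal (b i - a i) := by
  have h := (PiLp.volume_preserving_ofLp (Fin k)).measure_preimage
    (s := Set.pi univ fun i => Icc (a i) (b i))
    (MeasurableSet.univ_pi fun i => measurableSet_Icc).nullMeasurableSet
  rw [volume_pi_pi] at h
  simp only [Real.volume_Icc] at h
  rw [← h]
  congr 1
  ext x
  simp only [mem_preimage, Set.mem_pi, mem_univ, true_imp_iff]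
  rfl

section Grid

variable {k m : ℕ}

/-- The part of the cell `j` of the grid of mesh `1 / m` where the bumps are equal to `1`. -/
def gridCell (η : ℝ) (j : Fin k → Fin m) : Set (Cube k) :=
  {x | ∀ i, ((m : ℝ) • x.1 - cellShift j) i ∈ Icc η (1 - η)}

/-- The boundary with bumps of height `h` in the cells selected by `σ`, on top of `h`. -/
noncomputable def gridBoundary (φ : EuclideanSpace ℝ (Fin k) → ℝ) (h : ℝ)
    (σ : (Fin k → Fin m) → Bool) (x : Cube k) : ℝ :=
  h * bumpField φ σ ((m : ℝ) • x.1)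

theorem measurableSet_unitCube (k : ℕ) : MeasurableSet (unitCube k) :=
  (isClosed_setOf_forall_mem_Icc k 0 1).measurableSet

theorem measurableSet_gridCell (η : ℝ) (j : Fin k → Fin m) : MeasurableSet (gridCell η j) := by
  have h := ((isClosed_setOf_forall_mem_Icc k η (1 - η)).preimage
    (f := fun x : Cube k => (m : ℝ) • x.1 - cellShift j) (by fun_prop))
  exact h.measurableSet

theorem cubeVolume_gridCell {η : ℝ} (hη : 0 ≤ η) (hm : 0 < m) (j : Fin k → Fin m) :
    cubeVolume k (gridCell η j) = ENNReal.ofReal ((1 - 2 * η) / m) ^ k := by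
  have hm' : (0 : ℝ) < m := by exact_mod_cast hm
  rw [cubeVolume, (MeasurableEmbedding.subtype_coe (measurableSet_unitCube k)).comap_apply]
  have e : Subtype.val '' gridCell η j = {x : EuclideanSpace ℝ (Fin k) |
      ∀ i, x i ∈ Icc (((j i : ℕ) + η) / m) (((j i : ℕ) + 1 - η) / m)} := by
    have hiff : ∀ (x : EuclideanSpace ℝ (Fin k)) (i : Fin k),
        ((m : ℝ) • x - cellShift j) i ∈ Icc η (1 - η) ↔
        x i ∈ Icc (((j i : ℕ) + η) / m) (((j i : ℕ) + 1 - η) / m) := by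
      intro x i
      have : ((m : ℝ) • x - cellShift j) i = m * x i - (j i : ℕ) := by simp [cellShift]
      rw [this, mem_Icc, mem_Icc, div_le_iff₀ hm', le_div_iff₀ hm']
      constructor <;> rintro ⟨h1, h2⟩ <;> constructor <;> linarith
    ext x
    constructor
    · rintro ⟨y, hy, rfl⟩ i
      exact (hiff _ i).1 (hy i)
    · intro hx
      refine ⟨⟨x, fun i => ?_⟩, fun i => (hiff x i).2 (hx i), rfl⟩
      have h1 := hx i
      have h2 : ((j i : ℕ) : ℝ) + 1 ≤ m := by exact_mod_cast (j i).2
      refine ⟨le_trans (by positivity) h1.1, h1.2.trans ?_⟩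
      rw [div_le_one hm']
      linarith
  rw [e, volume_setOf_forall_mem_Icc]
  have : ∀ i, ((j i : ℕ) + 1 - η) / (m : ℝ) - ((j i : ℕ) + η) / m = (1 - 2 * η) / m := fun i => by
    ring
  simp only [this, Finset.prod_const, Finset.card_univ, Fintype.card_fin]

variable {η : ℝ} {φ : EuclideanSpace ℝ (Fin k) → ℝ}

theorem isCellFamily_gridBoundary (hφ : IsBump η φ) (hη : 0 < η) (hηk : 4 * k * η ≤ 1)
    (hk : 0 < k) (hm : 0 < m) (h : ℝ) :
    IsCellFamily h (gridCell (m := m) η) (gridBoundary φ h) where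
  measurableSet_cell := measurableSet_gridCell η
  disjoint_cell := by
    intro j j' hne
    rw [Function.onFun, Set.disjoint_left]
    intro x hx hx'
    exact hne (cellShift_eq_of_mem
      (fun i => ⟨hη.le.trans (hx i).1, by linarith [(hx i).2]⟩)
      (fun i => ⟨hη.le.trans (hx' i).1, by linarith [(hx' i).2]⟩))
  volume_cell j := by
    have hk' : (1 : ℝ) ≤ k := by exact_mod_cast hk
    have hη4 : 4 * η ≤ 1 := by nlinarith
    have hm' : (0 : ℝ) < m := by exact_mod_cast hm
    rw [cubeVolume_gridCell hη.le hm, ← ENNReal.ofReal_pow (div_nonneg (by linarith) hm'.le)]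
    refine ENNReal.ofReal_le_ofReal ?_
    -- Bernoulli's inequality: `(1 - 2 η) ^ k ≥ 1 - 2 k η ≥ 1 / 2`, so trimming the cells keeps half
    -- of their volume.
    have h1 := one_add_mul_le_pow (a := -(2 * η)) (by linarith) k
    have h2 : (1 : ℝ) / 2 ≤ (1 - 2 * η) ^ k := by
      rw [← sub_eq_add_neg] at h1
      linarith
    simp only [Fintype.card_fun, Fintype.card_fin, Nat.cast_pow]
    rw [div_pow, ← div_div]
    gcongr
  apply_eq σ j x hx := by
    rw [gridBoundary, hφ.bumpField_eq σ fun i => ⟨hη.le.trans (hx i).1, by linarith [(hx i).2]⟩,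
      hφ.eq_one _ hx, smul_eq_mul, mul_one]

theorem gridBoundary_mem_Icc (hφ : IsBump η φ) {h : ℝ} (hh : 0 ≤ h)
    (σ : (Fin k → Fin m) → Bool) (x : Cube k) : gridBoundary φ h σ x ∈ Icc h (2 * h) := by
  have := hφ.bumpField_mem_Icc σ ((m : ℝ) • x.1)
  unfold gridBoundary
  constructor <;> nlinarith [this.1, this.2]

theorem zoneHeight_gridBoundary (hφ : IsBump η φ) (hk : 0 < k) {h : ℝ} (hh : 0 ≤ h)
    (hh1 : 4 * h ≤ 1) (σ : (Fin k → Fin m) → Bool) : zoneHeight (gridBoundary φ h σ) = 4 * h := by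
  have h0 : gridBoundary φ h σ (cubeZero k) = h := by
    rw [gridBoundary, cubeZero, smul_zero, hφ.bumpField_zero hk, mul_one]
  rw [zoneHeight, h0, if_pos ⟨fun x => (gridBoundary_mem_Icc hφ hh σ x).2, by linarith, hh1⟩]

theorem isHolderSmooth_gridBoundary (hφ : IsBump η φ) {B γ K h : ℝ} (hγ : 0 ≤ γ) (hh : 0 ≤ h)
    (hm : 0 < m) (hB : ∀ i ≤ ⌊γ⌋₊ + 1, ∀ x, ‖iteratedFDeriv ℝ i φ x‖ ≤ B)
    (hK : h * (m : ℝ) ^ γ * ((⌊γ⌋₊ + 2) * (1 + B)) ≤ K) (σ : (Fin k → Fin m) → Bool) :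
    IsHolderSmooth K γ (gridBoundary φ h σ) :=
  isHolderSmooth_of_iteratedFDeriv_le (hφ.contDiff_bumpField σ) hγ hh (by exact_mod_cast hm)
    (fun i hi x => hφ.iteratedFDeriv_bumpField_le hB σ i hi x) hK fun _ => rfl

end Grid

theorem sum_mul_log_self {R : Type*} [Fintype R] (p : R → ℝ) :
    ∑ r, p r * Real.log (p r / ((p r + p r) / 2)) = 0 := by
  refine Finset.sum_eq_zero fun r _ => ?_
  rw [add_self_div_two]
  rcases eq_or_ne (p r) 0 with h | h
  · simp [h]
  · simp [div_self h]

theorem trueLabel_eq_of_eq {k : ℕ} {g g' : Cube k → ℝ} {x : Instance k} (h : g x.1 = g' x.1) :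
    trueLabel g x = trueLabel g' x := by
  rw [trueLabel, trueLabel, h]

/-- The information about the bit of its column in an answer of the labeler. -/
theorem sum_zoneLabeler_mul_log_le {k m : ℕ} {f : ℝ → ℝ} {C β η h : ℝ}
    {φ : EuclideanSpace ℝ (Fin k) → ℝ} (hf : MonotoneOn f (Icc 0 1))
    (hf' : MapsTo f (Icc 0 1) (Icc 0 1)) (hC : C ∈ Icc (0 : ℝ) 1) (hβ : 0 ≤ β)
    (hφ : IsBump η φ) (hk : 0 < k) (hh : 0 ≤ h) (hh1 : 4 * h ≤ 1)
    (hgm : ∀ σ : (Fin k → Fin m) → Bool, Measurable (gridBoundary φ h σ))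
    {col : Instance k → Fin k → Fin m}
    (hcol : ∀ x (σ σ' : (Fin k → Fin m) → Bool), σ (col x) = σ' (col x) →
      gridBoundary φ h σ x.1 = gridBoundary φ h σ' x.1)
    (σ : (Fin k → Fin m) → Bool) (j : Fin k → Fin m) (x : Instance k) :
    let P := fun σ => zoneLabeler k hf hf' hC hβ (gridBoundary φ h σ)
    ∑ r, ((P σ).prob x r).toReal * Real.log (((P σ).prob x r).toReal /
      ((((P σ).prob x r).toReal + ((P (flipBit j σ)).prob x r).toReal) / 2))
        ≤ if col x = j then f (4 * h) * (C * (4 * h) ^ β) ^ 2 else 0 := by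
  intro P
  have hP : ∀ σ r, ((P σ).prob x r).toReal = answerProb (f (max (4 * h) x.2))
      (zoneNoise C β (4 * h) x.2) (trueLabel (gridBoundary φ h σ) x) r := by
    intro σ r
    simp only [P]
    rw [zoneLabeler_of_measurable hf hf' hC hβ (hgm σ), toReal_zoneLaw_prob,
      zoneHeight_gridBoundary hφ hk hh hh1]
  simp only [hP]
  have hH : 4 * h ∈ Icc (0 : ℝ) 1 := ⟨by linarith, hh1⟩
  have hθ : 0 ≤ f (4 * h) * (C * (4 * h) ^ β) ^ 2 := mul_nonneg (hf' hH).1 (sq_nonneg _)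
  have hsame : trueLabel (gridBoundary φ h σ) x = trueLabel (gridBoundary φ h (flipBit j σ)) x →
      ∑ r, answerProb (f (max (4 * h) x.2)) (zoneNoise C β (4 * h) x.2)
        (trueLabel (gridBoundary φ h σ) x) r * Real.log (answerProb (f (max (4 * h) x.2))
        (zoneNoise C β (4 * h) x.2) (trueLabel (gridBoundary φ h σ) x) r /
        ((answerProb (f (max (4 * h) x.2)) (zoneNoise C β (4 * h) x.2)
          (trueLabel (gridBoundary φ h σ) x) r + answerProb (f (max (4 * h) x.2))
          (zoneNoise C β (4 * h) x.2) (trueLabel (gridBoundary φ h (flipBit j σ)) x) r) / 2))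
        = 0 := by
    intro e
    rw [← e]
    exact sum_mul_log_self _
  by_cases hj : col x = j
  · rw [if_pos hj]
    by_cases hx : (x.2 : ℝ) ≤ 4 * h
    · have hν : zoneNoise C β (4 * h) x.2 = 1 / 2 * (1 - C * (4 * h) ^ β) := if_pos hx
      rw [max_eq_left hx, hν]
      exact sum_answerProb_mul_log_le (hf' hH) (mul_rpow_mem_Icc hC hβ hH) _ _
    -- Above the zone every boundary of the family lies below the instance, so the label is `1` for
    -- all `σ`.
    · refine (hsame ?_).trans_le hθ
      have : ∀ σ : (Fin k → Fin m) → Bool, trueLabel (gridBoundary φ h σ) x = true := fun σ => by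
        rw [trueLabel, decide_eq_true_iff]
        linarith [(gridBoundary_mem_Icc hφ hh σ x.1).2]
      rw [this, this]
  · rw [if_neg hj]
    refine (hsame (trueLabel_eq_of_eq (hcol x _ _ ?_))).le
    rw [flipBit, Function.update_of_ne hj]

/-! ### Query complexity and the final choice of constants -/

theorem ActiveLearner.exists_le_successProb_of_queryComplexity_lt {k : ℕ} {A : ActiveLearner k}
    {ε δ : ℝ} {L : Labeler k} {g : Cube k → ℝ} {b : ℝ≥0∞}
    (h : (A.queryComplexity ε δ L g : ℝ≥0∞) < b) :
    ∃ N : ℕ, ENNReal.ofReal (1 - δ) ≤ A.successProb (L g) g ε N ∧ (N : ℝ≥0∞) < b := by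
  obtain ⟨n, hn⟩ : ∃ n : ℕ, A.queryComplexity ε δ L g = n := by
    have : A.queryComplexity ε δ L g ≠ ⊤ := fun h0 => by simp [h0] at h
    exact (ENat.ne_top_iff_exists.1 this).imp fun _ h => h.symm
  have hlt : A.queryComplexity ε δ L g < ((n + 1 : ℕ) : ℕ∞) := by
    rw [hn]
    exact_mod_cast n.lt_succ_self
  rw [ActiveLearner.queryComplexity] at hlt
  obtain ⟨N, hN⟩ := iInf_lt_iff.1 hlt
  obtain ⟨hs, hN⟩ := iInf_lt_iff.1 hN
  refine ⟨N, hs, lt_of_le_of_lt ?_ h⟩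
  rw [hn]
  have : N < n + 1 := by exact_mod_cast hN
  simpa using (by omega : N ≤ n)

/-- One of the boundaries of a family is hard to learn if all the probabilities of success add up
to less than they should for small query budgets. -/
theorem ActiveLearner.exists_le_queryComplexity {k : ℕ} (A : ActiveLearner k) {ε δ : ℝ}
    {L : Labeler k} {ι : Type*} [Fintype ι] [Nonempty ι] (g : ι → Cube k → ℝ) {b : ℝ≥0∞}
    (h : ∀ N : ℕ, (N : ℝ≥0∞) < b → ∑ i, A.successProb (L (g i)) (g i) ε N
      < Fintype.card ι * ENNReal.ofReal (1 - δ)) :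
    ∃ i, b ≤ (A.queryComplexity ε δ L (g i) : ℝ≥0∞) := by
  by_contra! hcon
  choose N hN hNb using fun i => exists_le_successProb_of_queryComplexity_lt (hcon i)
  -- The largest of the finitely many budgets serves all boundaries at once, since success is
  -- monotone in the budget.
  obtain ⟨i₀, hi₀⟩ := Finite.exists_max N
  refine (h (N i₀) (hNb i₀)).not_ge ?_
  rw [← nsmul_eq_mul, ← Finset.card_univ]
  exact Finset.card_nsmul_le_sum _ _ _ fun i _ =>
    (hN i).trans (A.successProb_mono _ _ _ (hi₀ i))

/-- The number of cells per side of a grid on which bumps of height `h` are smooth. -/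
theorem exists_grid_size {c γ h : ℝ} (hγ : 0 < γ) (hh : 0 < h) (hhc : h ≤ c) :
    ∃ m : ℕ, 0 < m ∧ h * (m : ℝ) ^ γ ≤ c ∧ (c / h) ^ (1 / γ) ≤ 2 * m := by
  have h1 : 1 ≤ c / h := (one_le_div hh).2 hhc
  have h2 : 1 ≤ (c / h) ^ (1 / γ) := Real.one_le_rpow h1 (by positivity)
  have hm : 0 < ⌊(c / h) ^ (1 / γ)⌋₊ := Nat.floor_pos.2 h2
  refine ⟨⌊(c / h) ^ (1 / γ)⌋₊, hm, ?_, ?_⟩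
  · have h3 : ((⌊(c / h) ^ (1 / γ)⌋₊ : ℕ) : ℝ) ^ γ ≤ c / h := by
      calc _ ≤ ((c / h) ^ (1 / γ)) ^ γ :=
            Real.rpow_le_rpow (Nat.cast_nonneg _) (Nat.floor_le (by positivity)) hγ.le
        _ = c / h := by
          rw [← Real.rpow_mul (by linarith), one_div_mul_cancel hγ.ne', Real.rpow_one]
    rw [mul_comm]
    exact (le_div_iff₀ hh).1 h3
  · have h3 := (Nat.lt_floor_add_one ((c / h) ^ (1 / γ))).le
    have h4 : (1 : ℝ) ≤ ⌊(c / h) ^ (1 / γ)⌋₊ := by exact_mod_cast hm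
    linarith

/-- A budget of `n` queries below the claimed bound keeps the total information small. -/
theorem mul_information_le {k m : ℕ} {n a c γ C β ε : ℝ} (hC : C ∈ Icc (0 : ℝ) 1)
    (hc : 0 < c) (hε : 0 < ε) (hm : (c / (64 * ε)) ^ (1 / γ) ≤ 2 * m)
    (hn : n * a ≤ (c / 64) ^ (k / γ) / (2 ^ k * 64 * 256 ^ (2 * β)) * ε ^ (-2 * β - k / γ)) :
    n * (a * (C * (256 * ε) ^ β) ^ 2) ≤ (m : ℝ) ^ k / 64 := by
  have hH0 : 0 ≤ 256 * ε := by positivity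
  have h2 : (C * (256 * ε) ^ β) ^ 2 ≤ 256 ^ (2 * β) * ε ^ (2 * β) := by
    rw [← Real.mul_rpow (by norm_num) hε.le, mul_comm 2 β, Real.rpow_mul hH0, Real.rpow_two]
    have h3 := Real.rpow_nonneg hH0 β
    exact pow_le_pow_left₀ (mul_nonneg hC.1 h3) (mul_le_of_le_one_left h3 hC.2) 2
  have h4 : (c / 64) ^ ((k : ℝ) / γ) * ε ^ (-((k : ℝ) / γ)) ≤ 2 ^ k * (m : ℝ) ^ k := by
    rw [← mul_pow, Real.rpow_neg hε.le, ← div_eq_mul_inv,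
      ← Real.div_rpow (by positivity) hε.le, div_div]
    calc (c / (64 * ε)) ^ ((k : ℝ) / γ) = ((c / (64 * ε)) ^ (1 / γ)) ^ k := by
          rw [← Real.rpow_natCast, ← Real.rpow_mul (by positivity)]
          congr 1
          ring
      _ ≤ _ := pow_le_pow_left₀ (by positivity) hm k
  calc n * (a * (C * (256 * ε) ^ β) ^ 2) = n * a * (C * (256 * ε) ^ β) ^ 2 := by ring
    _ ≤ (c / 64) ^ ((k : ℝ) / γ) / (2 ^ k * 64 * 256 ^ (2 * β)) * ε ^ (-2 * β - k / γ) *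
        (256 ^ (2 * β) * ε ^ (2 * β)) :=
      mul_le_mul hn h2 (sq_nonneg _) (by positivity)
    _ = (c / 64) ^ ((k : ℝ) / γ) / (2 ^ k * 64) * (ε ^ (-2 * β - k / γ) * ε ^ (2 * β)) := by
      field_simp
    _ = ((c / 64) ^ ((k : ℝ) / γ) * ε ^ (-((k : ℝ) / γ))) / (2 ^ k * 64) := by
      rw [← Real.rpow_add hε, show -2 * β - (k : ℝ) / γ + 2 * β = -(k / γ) by ring]
      ring
    _ ≤ 2 ^ k * (m : ℝ) ^ k / (2 ^ k * 64) := by gcongr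
    _ = _ := by field_simp

/-- The lower bound with the constants `δ₀ = 1 / 4` and `c₀ = 256`. -/
theorem exists_zoneLabeler_lower_bound {k : ℕ} (hk : 0 < k) {K γ C β : ℝ} (hK : 0 < K)
    (hγ : 1 ≤ γ) (hC : C ∈ Icc (0 : ℝ) 1) (hβ : 0 ≤ β) :
    ∃ κ ε₀ : ℝ, 0 < κ ∧ 0 < ε₀ ∧ 256 * ε₀ ≤ 1 ∧
      ∀ (f : ℝ → ℝ) (hf : MonotoneOn f (Icc 0 1)) (hf' : MapsTo f (Icc 0 1) (Icc 0 1))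
        (A : ActiveLearner k) (ε : ℝ), 0 < ε → ε ≤ ε₀ → ∃ g ∈ smoothBoundaries k K γ,
          ENNReal.ofReal (κ * ε ^ (-2 * β - k / γ)) / ENNReal.ofReal (f (256 * ε)) ≤
            (A.queryComplexity ε (1 / 4) (zoneLabeler k hf hf' hC hβ) g : ℝ≥0∞) := by
  have hk' : (0 : ℝ) < k := by exact_mod_cast hk
  have hγ0 : 0 < γ := by linarith
  set η : ℝ := 1 / (4 * k) with hη
  have hη0 : 0 < η := by positivity
  have hηk : 4 * k * η ≤ 1 := by rw [hη]; field_simp; rfl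
  obtain ⟨φ, hφ⟩ := exists_isBump k hη0
  obtain ⟨B, hB⟩ := hφ.exists_iteratedFDeriv_le (⌊γ⌋₊ + 1)
  have hB0 : 0 ≤ B := (norm_nonneg _).trans (hB 0 (by omega) 0)
  set D : ℝ := (⌊γ⌋₊ + 2) * (1 + B) with hD
  have hD0 : 0 < D := by positivity
  set c : ℝ := K / D with hc
  have hc0 : 0 < c := by positivity
  -- In `κ`, the factor `2 ^ k` pays for rounding the grid size, `64` for the budget `N θ ≤ M / 64`,
  -- and `256 ^ (2 * β)` for the bias at height `256 ε`. In `ε₀`, the bound `1 / 256` gives `4 h ≤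
  -- 1`, and `c / 64` gives `h ≤ c`, so that the grid has a cell.
  refine ⟨(c / 64) ^ (k / γ) / (2 ^ k * 64 * 256 ^ (2 * β)), min (1 / 256) (c / 64),
    by positivity, by positivity, by linarith [min_le_left (1 / 256) (c / 64)], ?_⟩
  intro f hf hf' A ε hε hε₀
  have hε1 : ε ≤ 1 / 256 := hε₀.trans (min_le_left _ _)
  have hε2 : ε ≤ c / 64 := hε₀.trans (min_le_right _ _)
  set h : ℝ := 64 * ε with hh
  have hh0 : 0 < h := by positivity
  have hh1 : 4 * h ≤ 1 := by linarith
  have hH : 256 * ε = 4 * h := by rw [hh]; ring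
  have hHI : 4 * h ∈ Icc (0 : ℝ) 1 := ⟨by linarith, hh1⟩
  obtain ⟨m, hm, hmc, hmh⟩ := exists_grid_size hγ0 hh0 (by linarith : h ≤ c)
  have hsm : ∀ σ : (Fin k → Fin m) → Bool, IsHolderSmooth K γ (gridBoundary φ h σ) := by
    refine isHolderSmooth_gridBoundary hφ hγ0.le hh0.le hm hB ?_
    rw [← hD, ← le_div_iff₀ hD0]
    exact hmc
  have hmem : ∀ σ : (Fin k → Fin m) → Bool, gridBoundary φ h σ ∈ smoothBoundaries k K γ :=
    fun σ => ⟨hsm σ, fun x => ⟨hh0.le.trans (gridBoundary_mem_Icc hφ hh0.le σ x).1,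
      (gridBoundary_mem_Icc hφ hh0.le σ x).2.trans (by linarith)⟩⟩
  have : Nonempty (Fin k → Fin m) := ⟨fun _ => ⟨0, hm⟩⟩
  choose col hcol using fun x : Instance k =>
    hφ.exists_forall_bumpField_eq (fun _ => ⟨0, hm⟩) ((m : ℝ) • x.1.1)
  suffices hlt : ∀ N : ℕ, (N : ℝ≥0∞) < ENNReal.ofReal ((c / 64) ^ (k / γ) /
      (2 ^ k * 64 * 256 ^ (2 * β)) * ε ^ (-2 * β - k / γ)) / ENNReal.ofReal (f (256 * ε)) →
      ∑ σ : (Fin k → Fin m) → Bool, A.successProb (zoneLabeler k hf hf' hC hβ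
        (gridBoundary φ h σ)) (gridBoundary φ h σ) ε N <
        Fintype.card ((Fin k → Fin m) → Bool) * ENNReal.ofReal (1 - 1 / 4) by
    obtain ⟨σ, hσ⟩ := A.exists_le_queryComplexity (gridBoundary (m := m) φ h) hlt
    exact ⟨_, hmem σ, hσ⟩
  intro N hN
  have hcard : (Fintype.card (Fin k → Fin m) : ℝ) = (m : ℝ) ^ k := by simp
  have hNθ : N * (f (4 * h) * (C * (4 * h) ^ β) ^ 2) ≤ Fintype.card (Fin k → Fin m) / 64 := by
    -- This form also covers `f (256 ε) = 0`: the bound is then infinite, every `N` is admitted, and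
    -- the information is zero.
    have h1 := ENNReal.mul_le_of_le_div hN.le
    rw [hH, ← ENNReal.ofReal_natCast, ← ENNReal.ofReal_mul (Nat.cast_nonneg _),
      ENNReal.ofReal_le_ofReal_iff (by positivity)] at h1
    rw [hcard, ← hH]
    exact mul_information_le hC hc0 hε hmh (hH ▸ h1)
  have hsum := A.sum_successProb_le (isCellFamily_gridBoundary hφ hη0 hηk hk hm h) hε hh
    (P := fun σ => zoneLabeler k hf hf' hC hβ (gridBoundary φ h σ)) col
    (fun σ j x => sum_zoneLabeler_mul_log_le hf hf' hC hβ hφ hk hh0.le hh1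
      (fun σ => (hsm σ).measurable)
      (fun x σ σ' e => congrArg (h * ·) (hcol x σ σ' e)) σ j x) hNθ
  refine hsum.trans_lt ?_
  rw [← ENNReal.ofReal_natCast, ← ENNReal.ofReal_mul (Nat.cast_nonneg _)]
  have hpos : (0 : ℝ) < Fintype.card ((Fin k → Fin m) → Bool) := by exact_mod_cast Fintype.card_pos
  -- Here `11 / 15 < 3 / 4 = 1 - δ₀` is used.
  exact (ENNReal.ofReal_lt_ofReal_iff (by positivity)).2 (by linarith)

theorem mainTheorem5 :
    ∃ δ₀ c₀ : ℝ, 0 < δ₀ ∧ δ₀ < 1 ∧ 0 < c₀ ∧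
      ∀ (d : ℕ) (K γ C β : ℝ), 2 ≤ d → 0 < K → 1 ≤ γ → 0 ≤ C → C ≤ 1 → 0 ≤ β →
        ∃ κ ε₀ : ℝ, 0 < κ ∧ 0 < ε₀ ∧ c₀ * ε₀ ≤ 1 ∧
          ∀ f : ℝ → ℝ, MonotoneOn f (Icc 0 1) → MapsTo f (Icc 0 1) (Icc 0 1) →
            ∃ L : Labeler (d - 1),
              (∀ g ∈ smoothBoundaries (d - 1) K γ,
                MonotoneAbstention g (L g) ∧ BoundedNoise f C β g (L g)) ∧
              ∀ (A : ActiveLearner (d - 1)) (ε : ℝ), 0 < ε → ε ≤ ε₀ →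
                ∃ g ∈ smoothBoundaries (d - 1) K γ,
                  ENNReal.ofReal (κ * ε ^ (-2 * β - ((d : ℝ) - 1) / γ)) /
                      ENNReal.ofReal (f (c₀ * ε)) ≤
                    (A.queryComplexity ε δ₀ L g : ℝ≥0∞) := by
  refine ⟨1 / 4, 256, by norm_num, by norm_num, by norm_num, ?_⟩
  intro d K γ C β hd hK hγ hC0 hC1 hβ
  have hC : C ∈ Icc (0 : ℝ) 1 := ⟨hC0, hC1⟩
  obtain ⟨κ, ε₀, hκ, hε₀, hε₀', H⟩ :=
    exists_zoneLabeler_lower_bound (by omega : 0 < d - 1) hK hγ hC hβ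
  rw [Nat.cast_pred (by omega)] at H
  refine ⟨κ, ε₀, hκ, hε₀, hε₀', fun f hf hf' => ⟨zoneLabeler (d - 1) hf hf' hC hβ, ?_, H f hf hf'⟩⟩
  intro g hg
  rw [zoneLabeler_of_measurable hf hf' hC hβ hg.1.measurable]
  exact ⟨monotoneAbstention_zoneLaw hf hf' hC hβ hg.1.measurable hg.2,
    boundedNoise_zoneLaw hf hf' hC hβ hg.1.measurable hg.2⟩
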